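/- **Setting.** Let $I=[a,b]$ with $a<b$, let $B:I\to\mathbb R_{>0}$ be continuous, and for $0<\beta\le 1$ put $$D_\beta=\{(u^1,u^2): u^1\in I,\ -\beta B(u^1)\le u^2\le \beta B(u^1)\},\qquad D=D_1 .$$ Let $g_{[0]}=(g_{[0]ij})$ be a smooth Riemannian metric on $D$ (smooth up to the boundary) for which the coordinates form a centered global chart: $g_{[0]ij}(u^1,0)=\delta_{ij}$ for $u^1\in I$, and every curve $u^1=\text{const}$ is a $g_{[0]}$-geodesic with unit tangent vector $\partial/\partial u^2$. The center curve is $C=\{u^2=0\}$, with geodesic curvature $\kappa_{[0]}(u^1)$, and $(D_\beta,g_{[0]})$, $0<\beta\le1$, is the breadth-parametrized strip shape. Let the stiffness tensor be isotropic with constant Lamé parameters $\lambda,\mu$, $$C^{ijkl}=\lambda\, g_{[0]}^{*ij}g_{[0]}^{*kl}+\mu\,(g_{[0]}^{*ik}g_{[0]}^{*jl}+g_{[0]}^{*il}g_{[0]}^{*jk}),$$ and positive definite on symmetric $2$-tensors. For a map $\boldsymbol p:D_\beta\to\mathbb R^2$ let $g_{[t]ij}=\partial_i\boldsymbol p\cdot\partial_j\boldsymbol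 p$ be the induced metric, $E=\frac12(g_{[t]}-g_{[0]})$ Green's strain tensor, and $$W_\beta(\boldsymbol p)=\int_{D_\beta}\tfrac12\, C^{ijkl}E_{ij}E_{kl}\sqrt{\det g_{[0]}}\;du^1du^2$$ the strain energy. Fix $k\in\{1,2,\dots,\infty\}$. For every $\beta\in(0,1]$ let $\boldsymbol p_\beta$ minimize $W_\beta$ among all orientation-preserving $C^k$ embeddings $D_\beta\to\mathbb R^2$ ($C^k$ up to the boundary). Let $J\subseteq I$ be a closed interval of positive length (for instance $J=I$) over which the minimizers form a family smooth up to $\beta=0$: there is a $C^\infty$ map $Q:\mathbb R^3\to\mathbb R^2$ with $\boldsymbol p_\beta(u^1,u^2)=Q(u^1,u^2,\beta)$ for all $\beta\in(0,1]$ and all $(u^1,u^2)\in D_\beta$ with $u^1\in J$. **Theorem.** Let $g_{[t]\beta}$ be the metric induced by $\boldsymbol p_\beta$ and let $\kappa_{[t]\beta}$ be the signed curvature of the plane curve $u^1\mapsto\boldsymbol p_\beta(u^1,0)$, $u^1\in J$. Then, as $\beta\to0^+$, $$g_{[t]\beta\, ij}(u^1,0)=g_{[0]ij}(u^1,0)+O(\beta^2)\quad(i,j=1,2),\qquad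 \kappa_{[t]\beta}(u^1)=\kappa_{[0]}(u^1)+O(\beta^2),$$ uniformly in $u^1\in J$. -/

import Mathlib

open Set Filter Topology MeasureTheory
open scoped ContDiff

noncomputable section

namespace ElasticStrip

/-- The Euclidean plane. -/
abbrev Plane : Type := EuclideanSpace ℝ (Fin 2)

/-- The coordinate vectors `(1, 0)` and `(0, 1)` of the chart domain. The index `0 : Fin 2` stands
for the coordinate `u¹` (along the strip) and `1 : Fin 2` for `u²` (across the strip). -/
def coordVec (i : Fin 2) : ℝ × ℝ := if i = 0 then (1, 0) else (0, 1)

/-- The component of a point of the chart domain. -/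
def comp (i : Fin 2) (u : ℝ × ℝ) : ℝ := if i = 0 then u.1 else u.2

/-- The partial derivative `∂f/∂uⁱ`. -/
def pd {F : Type*} [NormedAddCommGroup F] [NormedSpace ℝ F]
    (i : Fin 2) (f : ℝ × ℝ → F) (u : ℝ × ℝ) : F :=
  fderiv ℝ f u (coordVec i)

/-- A metric written in coordinates, `g u i j = g_{ij}(u)`. -/
abbrev MetricField : Type := ℝ × ℝ → Matrix (Fin 2) (Fin 2) ℝ

/-- The Christoffel symbol `Γⁱ_{jk}` of the metric `g`. -/
def christoffel (g : MetricField) (u : ℝ × ℝ) (i j k : Fin 2) : ℝ :=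
  (1 / 2) * ∑ l : Fin 2, (g u)⁻¹ i l *
    (pd j (fun v => g v k l) u + pd k (fun v => g v j l) u - pd l (fun v => g v j k) u)

/-- The velocity components of a curve in coordinates. -/
def velocity (γ : ℝ → ℝ × ℝ) (t : ℝ) (i : Fin 2) : ℝ :=
  deriv (fun τ => comp i (γ τ)) t

/-- The components of the covariant acceleration `(D/dt) γ'` of a curve in coordinates. -/
def covAccel (g : MetricField) (γ : ℝ → ℝ × ℝ) (t : ℝ) (i : Fin 2) : ℝ :=
  deriv (fun τ => velocity γ τ i) t +
    ∑ j : Fin 2, ∑ k : Fin 2, christoffel g (γ t) i j k * velocity γ t j * velocity γ t k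

/-- The curve `γ` satisfies the geodesic equation of `g` at all parameters in `T`. -/
def IsGeodesicOn (g : MetricField) (γ : ℝ → ℝ × ℝ) (T : Set ℝ) : Prop :=
  ∀ t ∈ T, ∀ i : Fin 2, covAccel g γ t i = 0

/-- The signed geodesic curvature `ω_g(γ', Dγ'/dt) / |γ'|_g³` of a curve, where
`ω_g = √(det g) du¹ ∧ du²` is the area form. -/
def geodesicCurvature (g : MetricField) (γ : ℝ → ℝ × ℝ) (t : ℝ) : ℝ :=
  Real.sqrt (g (γ t)).det *
      (velocity γ t 0 * covAccel g γ t 1 - velocity γ t 1 * covAccel g γ t 0) /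
    Real.sqrt (∑ i : Fin 2, ∑ j : Fin 2, g (γ t) i j * velocity γ t i * velocity γ t j) ^ 3

/-- The determinant of two plane vectors. -/
def det2 (x y : Plane) : ℝ := x 0 * y 1 - x 1 * y 0

/-- The signed curvature `det(c', c'') / |c'|³` of the plane curve `c : J → ℝ²`. At the end points
of the interval `J` the derivatives are one-sided. -/
def planarCurvature (J : Set ℝ) (c : ℝ → Plane) (t : ℝ) : ℝ :=
  det2 (derivWithin c J t) (derivWithin (derivWithin c J) J t) / ‖derivWithin c J t‖ ^ 3

/-- The region `{(u¹, u²) | a ≤ u¹ ≤ b, -β B(u¹) ≤ u² ≤ β B(u¹)}`. -/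
def stripDomain (a b : ℝ) (B : ℝ → ℝ) (β : ℝ) : Set (ℝ × ℝ) :=
  {u | u.1 ∈ Icc a b ∧ u.2 ∈ Icc (-(β * B u.1)) (β * B u.1)}

/-- A two-dimensional Riemannian manifold with a centered global chart. As the chart is global, the
manifold is identified with the image `D` of the chart, and its metric is given by the coefficients
`g_{ij}` on `D`. Smoothness on the closed region `D` means, as usual, being the restriction of a
smooth function on the plane; the values and derivatives of `g` on `D` do not depend on the choice
of the extension, and nothing else is used. -/
structure CenteredStrip where
  /-- left end of the interval `I = [a, b]` -/
  a : ℝ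
  /-- right end of the interval `I = [a, b]` -/
  b : ℝ
  a_lt_b : a < b
  /-- the breadth function -/
  B : ℝ → ℝ
  B_continuousOn : ContinuousOn B (Icc a b)
  B_pos : ∀ s ∈ Icc a b, 0 < B s
  /-- the metric of the reference state -/
  g : MetricField
  g_smooth : ∀ i j : Fin 2, ContDiff ℝ ∞ (fun u => g u i j)
  g_posDef : ∀ u ∈ stripDomain a b B 1, (g u).PosDef
  /-- the coordinate frame is orthonormal on the center curve -/
  g_center : ∀ s ∈ Icc a b, g (s, 0) = 1
  /-- the curves `u¹ = const` have unit tangent vector `∂/∂u²` -/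
  g_unit : ∀ u ∈ stripDomain a b B 1, g u 1 1 = 1
  /-- the curves `u¹ = const` are geodesics -/
  g_geodesic : ∀ s ∈ Icc a b, IsGeodesicOn g (fun τ => (s, τ)) (Icc (-(B s)) (B s))

namespace CenteredStrip

/-- The narrowed domain `D_β`; the full domain is `D = D_1`. -/
def D (S : CenteredStrip) (β : ℝ) : Set (ℝ × ℝ) := stripDomain S.a S.b S.B β

/-- The geodesic curvature `κ_[0]` of the center curve `s ↦ (s, 0)` in the reference state. -/
def centerCurvature (S : CenteredStrip) (s : ℝ) : ℝ :=
  geodesicCurvature S.g (fun t => (t, 0)) s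

end CenteredStrip

/-- A `(4, 0)`-tensor field in coordinates, `C u i j k l = C^{ijkl}(u)`. -/
abbrev StiffnessField : Type := ℝ × ℝ → Fin 2 → Fin 2 → Fin 2 → Fin 2 → ℝ

/-- `∑ C^{ijkl} X_{ij} Y_{kl}` -/
def StiffnessField.pair (C : StiffnessField) (u : ℝ × ℝ) (X Y : Matrix (Fin 2) (Fin 2) ℝ) : ℝ :=
  ∑ i : Fin 2, ∑ j : Fin 2, ∑ k : Fin 2, ∑ l : Fin 2, C u i j k l * X i j * Y k l

/-- `C` is isotropic with the constant Lamé parameters `lam` and `mu`. -/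
def StiffnessField.IsIsotropic (C : StiffnessField) (S : CenteredStrip) (lam mu : ℝ) : Prop :=
  ∀ u ∈ S.D 1, ∀ i j k l : Fin 2,
    C u i j k l = lam * ((S.g u)⁻¹ i j * (S.g u)⁻¹ k l) +
      mu * ((S.g u)⁻¹ i k * (S.g u)⁻¹ j l + (S.g u)⁻¹ i l * (S.g u)⁻¹ j k)

/-- `C` is positive definite on the symmetric 2-tensors at each point. -/
def StiffnessField.IsPositive (C : StiffnessField) (S : CenteredStrip) : Prop :=
  ∀ u ∈ S.D 1, ∀ X : Matrix (Fin 2) (Fin 2) ℝ, X.IsSymm → X ≠ 0 → 0 < C.pair u X X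

/-- The metric `g_[t]` induced by the map `p`, `g_[t]ij = ⟨∂p/∂uⁱ, ∂p/∂uʲ⟩`. -/
def inducedMetric (p : ℝ × ℝ → Plane) : MetricField :=
  fun u => Matrix.of fun i j => inner ℝ (pd i p u) (pd j p u)

/-- Green's strain tensor `E = (g_[t] - g_[0]) / 2`. -/
def strain (S : CenteredStrip) (p : ℝ × ℝ → Plane) (u : ℝ × ℝ) : Matrix (Fin 2) (Fin 2) ℝ :=
  (1 / 2 : ℝ) • (inducedMetric p u - S.g u)

/-- The strain energy `W = ∫_{M_β} (1/2) C(E, E) υ_[0]`. -/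
def energy (S : CenteredStrip) (C : StiffnessField) (β : ℝ) (p : ℝ × ℝ → Plane) : ℝ :=
  ∫ u in S.D β, (1 / 2) * C.pair u (strain S p u) (strain S p u) * Real.sqrt (S.g u).det

/-- `p` is, on the compact region `K`, an orientation preserving `C^k` embedding into the plane.
Being `C^k` on `K` means being the restriction of a `C^k` map of the plane. -/
structure IsOrientedEmbedding (k : ℕ∞) (K : Set (ℝ × ℝ)) (p : ℝ × ℝ → Plane) : Prop where
  contDiff : ContDiff ℝ k p
  injOn : InjOn p K
  orientation : ∀ u ∈ K, 0 < det2 (pd 0 p u) (pd 1 p u)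

/-- `p` minimizes the strain energy of the strip `M_β` among the embeddings of `M_β`. -/
structure IsEnergyMinimizer (S : CenteredStrip) (C : StiffnessField) (k : ℕ∞) (β : ℝ)
    (p : ℝ × ℝ → Plane) : Prop where
  embedding : IsOrientedEmbedding k (S.D β) p
  minimal : ∀ q : ℝ × ℝ → Plane, IsOrientedEmbedding k (S.D β) q →
    energy S C β p ≤ energy S C β q

/-- The maps `p β`, `0 < β ≤ 1`, form a family which over the part `u¹ ∈ J` of the strip is smooth
in `(u¹, u², β)` up to `β = 0`. -/
def IsSmoothFamilyOver (S : CenteredStrip) (J : Set ℝ) (p : ℝ → ℝ × ℝ → Plane) : Prop :=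
  ∃ Q : ℝ × ℝ × ℝ → Plane, ContDiff ℝ ∞ Q ∧
    ∀ β ∈ Ioc (0 : ℝ) 1, ∀ u ∈ S.D β, u.1 ∈ J → p β u = Q (u.1, u.2, β)

end ElasticStrip

end

/-! Write the strain of the minimizers over `J` as a smooth field `E(s, x, β)` (`familyStrain`),
with `s = u¹` and `x = u²`. On the strip `|x| ≤ β B(s)`, so `x` and `β` both count as order one, and
`E` is expanded in `(x, β)` around the center curve with coefficients depending on `s`. The metric
claim says that `E(s, 0, β) = O(β²)`. For the curvature, `inner_acceleration` shows that the scalar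
product of the acceleration with the transverse vector `∂p/∂u²` differs from `κ_[0]` by `2 ∂ₛE₀₁ -
∂ₓE₀₀`, and `abs_curvature_sub_le` converts this to curvature. It therefore suffices that `E`,
`E_x`, `E_β` and `E_{xβ}` vanish at `(s, 0, 0)`.

The vanishing of `E` comes from energy comparison: the chart itself, read as a map to the plane, has
energy `O(β³)` (`exists_energy_le`), whereas a nonzero limit strain would cost energy of order `β`
(`familyStrain_center`).

The vanishing of the derivatives comes from the Euler–Lagrange equation in weak form
(`firstVariation`). To leading order any strain variation `φ (x a + β b)` with symmetric `a(s)`,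
`b(s)` can be realized (`exists_test`): bending produces the `x`-linear longitudinal strain,
stretching and shearing the rest, and outside `J` the variation is infinitesimally rigid. Testing
with `a = E_x`, `b = E_β` makes the leading integrand a positive definite form in `x E_x + β E_β`,
so both vanish (`strainD_eq_zero`). Then `E` is of second order, and testing with `a = E_{xβ}`, `b =
0` gives an integrand in which `E_xx` and `E_ββ` are accompanied by odd powers of `x`. As the strip
is symmetric about `x = 0`, these integrate to zero and only the square of `E_{xβ}` survives
(`strainD2_eq_zero`). This parity argument is `even_coeff_eq_zero`. -/

namespace ElasticStrip

open Asymptotics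

/-! ### Orders of magnitude in `β` on the thin strip -/

/-- The points `(s, x, β)` with `s ∈ [c, d]`, `0 < β ≤ 1` and `|x| ≤ β B(s)`. -/
def thinRegion (c d : ℝ) (B : ℝ → ℝ) : Set (ℝ × ℝ × ℝ) :=
  {t | t.2.2 ∈ Ioc (0 : ℝ) 1 ∧ (t.1, t.2.1) ∈ stripDomain c d B t.2.2}

/-- `f = O(β ^ m)` uniformly on the thin region. -/
def ThinO (c d : ℝ) (B : ℝ → ℝ) (m : ℕ) (f : ℝ × ℝ × ℝ → ℝ) : Prop :=
  f =O[𝓟 (thinRegion c d B)] fun t => t.2.2 ^ m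

section ThinO

variable {c d : ℝ} {B : ℝ → ℝ} {m n : ℕ} {f g : ℝ × ℝ × ℝ → ℝ}

theorem thinO_iff : ThinO c d B m f ↔
    ∃ K : ℝ, ∀ t ∈ thinRegion c d B, |f t| ≤ K * t.2.2 ^ m := by
  unfold ThinO
  rw [isBigO_principal]
  refine exists_congr fun K => forall₂_congr fun t ht => ?_
  have : 0 ≤ t.2.2 := ht.1.1.le
  rw [Real.norm_eq_abs, Real.norm_eq_abs, abs_of_nonneg (pow_nonneg this m)]

theorem ThinO.exists_nonneg (h : ThinO c d B m f) :
    ∃ K : ℝ, 0 ≤ K ∧ ∀ t ∈ thinRegion c d B, |f t| ≤ K * t.2.2 ^ m := by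
  obtain ⟨K, hK⟩ := thinO_iff.1 h
  refine ⟨|K|, abs_nonneg _, fun t ht => (hK t ht).trans ?_⟩
  exact mul_le_mul_of_nonneg_right (le_abs_self K) (pow_nonneg ht.1.1.le m)

theorem ThinO.add (hf : ThinO c d B m f) (hg : ThinO c d B m g) :
    ThinO c d B m (fun t => f t + g t) := IsBigO.add hf hg

theorem ThinO.neg (hf : ThinO c d B m f) : ThinO c d B m (fun t => -f t) := IsBigO.neg_left hf

theorem ThinO.mul (hf : ThinO c d B m f) (hg : ThinO c d B n g) :
    ThinO c d B (m + n) (fun t => f t * g t) := by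
  have := IsBigO.mul hf hg
  simpa only [ThinO, pow_add] using this

theorem ThinO.const_mul (k : ℝ) (hf : ThinO c d B m f) : ThinO c d B m (fun t => k * f t) :=
  IsBigO.const_mul_left hf k

theorem thinO_zero : ThinO c d B m (fun _ => 0) := isBigO_zero _ _

theorem ThinO.sum {ι : Type*} {s : Finset ι} {f : ι → ℝ × ℝ × ℝ → ℝ}
    (h : ∀ i ∈ s, ThinO c d B m (f i)) : ThinO c d B m (fun t => ∑ i ∈ s, f i t) := by
  unfold ThinO
  simpa only [Finset.sum_fn] using IsBigO.sum h

theorem ThinO.congr (hf : ThinO c d B m f) (h : ∀ t ∈ thinRegion c d B, g t = f t) :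
    ThinO c d B m g := by
  obtain ⟨K, hK⟩ := thinO_iff.1 hf
  exact thinO_iff.2 ⟨K, fun t ht => by rw [h t ht]; exact hK t ht⟩

theorem ThinO.mono (hf : ThinO c d B m f) (h : n ≤ m) : ThinO c d B n f := by
  obtain ⟨K, hK0, hK⟩ := hf.exists_nonneg
  refine thinO_iff.2 ⟨K, fun t ht => (hK t ht).trans ?_⟩
  exact mul_le_mul_of_nonneg_left (pow_le_pow_of_le_one ht.1.1.le ht.1.2 h) hK0

theorem ThinO.mul_le {l : ℕ} (hf : ThinO c d B m f) (hg : ThinO c d B n g) (h : l ≤ m + n) :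
    ThinO c d B l (fun t => f t * g t) := (hf.mul hg).mono h

theorem exists_bound_breadth (hB : ContinuousOn B (Icc c d)) :
    ∃ M : ℝ, 0 ≤ M ∧ ∀ s ∈ Icc c d, B s ≤ M := by
  obtain ⟨M, hM⟩ := isCompact_Icc.exists_bound_of_continuousOn hB
  exact ⟨|M|, abs_nonneg _, fun s hs => (le_abs_self _).trans ((hM s hs).trans (le_abs_self _))⟩

theorem thinO_beta : ThinO c d B 1 (fun t => t.2.2) :=
  thinO_iff.2 ⟨1, fun t ht => by simp [abs_of_pos ht.1.1]⟩

theorem thinO_x (hB : ContinuousOn B (Icc c d)) : ThinO c d B 1 (fun t => t.2.1) := by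
  obtain ⟨M, hM0, hM⟩ := exists_bound_breadth hB
  refine thinO_iff.2 ⟨M, fun t ht => ?_⟩
  have h1 := abs_le.2 ht.2.2
  have h2 := hM t.1 ht.2.1
  have h3 := ht.1.1
  simp only at h1
  rw [pow_one]
  nlinarith

theorem thinO_of_continuous (hB : ContinuousOn B (Icc c d))
    (hf : Continuous f) : ThinO c d B 0 f := by
  obtain ⟨M, hM0, hM⟩ := exists_bound_breadth hB
  obtain ⟨K, hK⟩ := ((isCompact_Icc (a := c) (b := d)).prod
    ((isCompact_Icc (a := -M) (b := M)).prod
      (isCompact_Icc (a := (0 : ℝ)) (b := 1)))).exists_bound_of_continuousOn hf.continuousOn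
  refine thinO_iff.2 ⟨K, fun t ht => ?_⟩
  have h1 := abs_le.2 ht.2.2
  have h2 := hM t.1 ht.2.1
  have h3 := ht.1.1
  have h4 := ht.1.2
  simp only at h1
  have h5 : |t.2.1| ≤ M := by nlinarith
  rw [pow_zero, mul_one]
  exact hK t ⟨ht.2.1, abs_le.1 h5, h3.le, h4⟩

/-- A function that vanishes for `x = β = 0` gains one order over its partial derivatives. -/
theorem ThinO.of_partial (hB : ContinuousOn B (Icc c d)) (hf : Differentiable ℝ f)
    (h0 : ∀ s ∈ Icc c d, f (s, 0, 0) = 0) {f₁ f₂ : ℝ × ℝ × ℝ → ℝ}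
    (h₁ : ∀ s x β, HasDerivAt (fun y => f (s, y, β)) (f₁ (s, x, β)) x)
    (h₂ : ∀ s x β, HasDerivAt (fun y => f (s, x, y)) (f₂ (s, x, β)) β)
    (hO₁ : ThinO c d B m f₁) (hO₂ : ThinO c d B m f₂) : ThinO c d B (m + 1) f := by
  obtain ⟨M, hM0, hM⟩ := exists_bound_breadth hB
  obtain ⟨K₁, hK₁, hb₁⟩ := hO₁.exists_nonneg
  obtain ⟨K₂, hK₂, hb₂⟩ := hO₂.exists_nonneg
  refine thinO_iff.2 ⟨M * K₁ + K₂, ?_⟩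
  rintro ⟨s, x, β⟩ ht
  have hs : s ∈ Icc c d := ht.2.1
  have hβ : β ∈ Ioc (0 : ℝ) 1 := ht.1
  have hx : |x| ≤ β * B s := abs_le.2 ht.2.2
  have hder : ∀ r : ℝ, HasDerivAt (fun r : ℝ => f (s, r * x, r * β))
      (x * f₁ (s, r * x, r * β) + β * f₂ (s, r * x, r * β)) r := by
    intro r
    have hF := (hf (s, r * x, r * β)).hasFDerivAt
    have e1 : fderiv ℝ f (s, r * x, r * β) (0, 1, 0) = f₁ (s, r * x, r * β) := by
      have hc : HasDerivAt (fun y : ℝ => ((s, y, r * β) : ℝ × ℝ × ℝ)) (0, 1, 0) (r * x) :=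
        (hasDerivAt_const _ _).prodMk ((hasDerivAt_id _).prodMk (hasDerivAt_const _ _))
      exact (HasFDerivAt.comp_hasDerivAt (r * x) hF hc).unique (h₁ s (r * x) (r * β))
    have e2 : fderiv ℝ f (s, r * x, r * β) (0, 0, 1) = f₂ (s, r * x, r * β) := by
      have hc : HasDerivAt (fun y : ℝ => ((s, r * x, y) : ℝ × ℝ × ℝ)) (0, 0, 1) (r * β) :=
        (hasDerivAt_const _ _).prodMk ((hasDerivAt_const _ _).prodMk (hasDerivAt_id _))
      exact (HasFDerivAt.comp_hasDerivAt (r * β) hF hc).unique (h₂ s (r * x) (r * β))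
    have hc : HasDerivAt (fun r : ℝ => ((s, r * x, r * β) : ℝ × ℝ × ℝ)) (0, x, β) r := by
      have hx' := (hasDerivAt_id r).mul_const x
      have hβ' := (hasDerivAt_id r).mul_const β
      simp only [one_mul, id] at hx' hβ'
      exact (hasDerivAt_const _ _).prodMk (hx'.prodMk hβ')
    have := HasFDerivAt.comp_hasDerivAt r hF hc
    have hv : ((0, x, β) : ℝ × ℝ × ℝ) = x • (0, 1, 0) + β • (0, 0, 1) := by simp
    rw [hv, map_add, map_smul, map_smul, e1, e2] at this
    exact this
  -- Mean value theorem along the segment from `(s, 0, 0)` to `(s, x, β)`. The segment stays in the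
  -- thin region because `|x| ≤ β B(s)` is homogeneous in `(x, β)`; the intermediate `r` is
  -- positive, so the region's condition `β > 0` is kept.
  obtain ⟨r, hr, hslope⟩ := exists_hasDerivAt_eq_slope (fun r : ℝ => f (s, r * x, r * β))
    (fun r => x * f₁ (s, r * x, r * β) + β * f₂ (s, r * x, r * β)) one_pos
    (fun r _ => (hder r).continuousAt.continuousWithinAt) (fun r _ => hder r)
  simp only [one_mul, zero_mul, h0 s hs, sub_zero, div_one] at hslope
  have hmem : (s, r * x, r * β) ∈ thinRegion c d B := by
    refine ⟨⟨mul_pos hr.1 hβ.1, ?_⟩, hs, abs_le.1 ?_⟩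
    · exact mul_le_one₀ hr.2.le hβ.1.le hβ.2
    · change |r * x| ≤ r * β * B s
      rw [abs_mul, abs_of_pos hr.1, mul_assoc]
      exact mul_le_mul_of_nonneg_left hx hr.1.le
  have hpow : (r * β) ^ m ≤ β ^ m :=
    pow_le_pow_left₀ (mul_pos hr.1 hβ.1).le (mul_le_of_le_one_left hβ.1.le hr.2.le) m
  have b1 : |f₁ (s, r * x, r * β)| ≤ K₁ * β ^ m :=
    (hb₁ _ hmem).trans (mul_le_mul_of_nonneg_left hpow hK₁)
  have b2 : |f₂ (s, r * x, r * β)| ≤ K₂ * β ^ m :=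
    (hb₂ _ hmem).trans (mul_le_mul_of_nonneg_left hpow hK₂)
  have hx' : |x| ≤ β * M := hx.trans (mul_le_mul_of_nonneg_left (hM s hs) hβ.1.le)
  rw [← hslope]
  calc |x * f₁ (s, r * x, r * β) + β * f₂ (s, r * x, r * β)|
      ≤ |x| * |f₁ (s, r * x, r * β)| + β * |f₂ (s, r * x, r * β)| := by
        refine (abs_add_le _ _).trans ?_
        rw [abs_mul, abs_mul, abs_of_pos hβ.1]
    _ ≤ β * M * (K₁ * β ^ m) + β * (K₂ * β ^ m) := by
        have := hβ.1
        gcongr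
    _ = (M * K₁ + K₂) * β ^ (m + 1) := by ring

end ThinO

/-! ### Directional derivatives in `(s, x, β)` -/

/-- The derivative of `f` in the fixed direction `v`. -/
noncomputable def dirD {E F : Type*} [NormedAddCommGroup E] [NormedSpace ℝ E] [NormedAddCommGroup F]
    [NormedSpace ℝ F] (v : E) (f : E → F) (t : E) : F := fderiv ℝ f t v

/-- The direction of `s` among the coordinates `(s, x, β)`. -/
abbrev es : ℝ × ℝ × ℝ := (1, 0, 0)
/-- The direction of `x` among the coordinates `(s, x, β)`. -/
abbrev ex : ℝ × ℝ × ℝ := (0, 1, 0)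
/-- The direction of `β` among the coordinates `(s, x, β)`. -/
abbrev eb : ℝ × ℝ × ℝ := (0, 0, 1)

section dirD

variable {E F : Type*} [NormedAddCommGroup E] [NormedSpace ℝ E] [NormedAddCommGroup F]
  [NormedSpace ℝ F]

theorem contDiff_dirD {f : E → F} (hf : ContDiff ℝ ∞ f) (v : E) : ContDiff ℝ ∞ (dirD v f) := by
  have : ContDiff ℝ ∞ (fderiv ℝ f) := hf.fderiv_right (by norm_cast)
  exact this.clm_apply contDiff_const

theorem dirD_comm {f : E → F} (hf : ContDiff ℝ ∞ f) (v w : E) :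
    dirD v (dirD w f) = dirD w (dirD v f) := by
  funext t
  have hd : Differentiable ℝ (fderiv ℝ f) :=
    (hf.fderiv_right (m := ∞) (by norm_cast)).differentiable (by simp)
  have hsymm : IsSymmSndFDerivAt ℝ f t :=
    hf.contDiffAt.isSymmSndFDerivAt (by
      rw [minSmoothness_of_isRCLikeNormedField]; exact WithTop.coe_le_coe.2 le_top)
  have key : ∀ a b : E, dirD a (dirD b f) t = fderiv ℝ (fderiv ℝ f) t a b := by
    intro a b
    have := ((hd t).hasFDerivAt.clm_apply (hasFDerivAt_const b t)).fderiv
    change fderiv ℝ (fun t => fderiv ℝ f t b) t a = _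
    rw [this]; simp
  rw [key, key]
  exact hsymm.eq v w

variable {f : ℝ × ℝ × ℝ → F}

theorem hasDerivAt_slot_s (hf : Differentiable ℝ f) (s x β : ℝ) :
    HasDerivAt (fun y => f (y, x, β)) (dirD es f (s, x, β)) s :=
  HasFDerivAt.comp_hasDerivAt s (hf _).hasFDerivAt
    ((hasDerivAt_id s).prodMk (hasDerivAt_const s (x, β)))

theorem hasDerivAt_slot_x (hf : Differentiable ℝ f) (s x β : ℝ) :
    HasDerivAt (fun y => f (s, y, β)) (dirD ex f (s, x, β)) x :=
  HasFDerivAt.comp_hasDerivAt x (hf _).hasFDerivAt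
    ((hasDerivAt_const x s).prodMk ((hasDerivAt_id x).prodMk (hasDerivAt_const x β)))

theorem hasDerivAt_slot_b (hf : Differentiable ℝ f) (s x β : ℝ) :
    HasDerivAt (fun y => f (s, x, y)) (dirD eb f (s, x, β)) β :=
  HasFDerivAt.comp_hasDerivAt β (hf _).hasFDerivAt
    ((hasDerivAt_const β s).prodMk ((hasDerivAt_const β x).prodMk (hasDerivAt_id β)))

theorem contDiff_atCenter (hf : ContDiff ℝ ∞ f) : ContDiff ℝ ∞ (fun s : ℝ => f (s, 0, 0)) :=
  hf.comp (contDiff_id.prodMk contDiff_const)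

end dirD

/-! ### Taylor expansion in `(x, β)`, uniform in `s` -/

section Taylor

variable {c d : ℝ} {B : ℝ → ℝ} {f : ℝ × ℝ × ℝ → ℝ}

theorem smooth_thinO_zero (hB : ContinuousOn B (Icc c d)) (hf : ContDiff ℝ ∞ f) :
    ThinO c d B 0 f := thinO_of_continuous hB hf.continuous

theorem taylor_one (hB : ContinuousOn B (Icc c d)) (hf : ContDiff ℝ ∞ f) :
    ThinO c d B 1 (fun t => f t - f (t.1, 0, 0)) := by
  have hfd : Differentiable ℝ f := hf.differentiable (by simp)
  have h0 := contDiff_atCenter hf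
  refine ThinO.of_partial hB (hfd.sub ((h0.comp contDiff_fst).differentiable (by simp)))
    (fun s _ => by simp) (f₁ := dirD ex f) (f₂ := dirD eb f) ?_ ?_
    (smooth_thinO_zero hB (contDiff_dirD hf _)) (smooth_thinO_zero hB (contDiff_dirD hf _))
  · intro s x β
    simpa using (hasDerivAt_slot_x hfd s x β).sub_const (f (s, 0, 0))
  · intro s x β
    simpa using (hasDerivAt_slot_b hfd s x β).sub_const (f (s, 0, 0))

/-- The `x`- and `β`-derivatives of the remainder are the remainders, one order lower, of `∂ₓf` and
`∂_βf`. Hence each order follows from the preceding one by `ThinO.of_partial`; the same induction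
step gives `taylor_three`. -/
theorem taylor_two (hB : ContinuousOn B (Icc c d)) (hf : ContDiff ℝ ∞ f) :
    ThinO c d B 2 (fun t => f t - (f (t.1, 0, 0) + t.2.1 * dirD ex f (t.1, 0, 0)
      + t.2.2 * dirD eb f (t.1, 0, 0))) := by
  have hfd : Differentiable ℝ f := hf.differentiable (by simp)
  have h0 := (contDiff_atCenter hf).comp (contDiff_fst (F := ℝ × ℝ))
  have h1 := (contDiff_atCenter (contDiff_dirD hf ex)).comp (contDiff_fst (F := ℝ × ℝ))
  have h2 := (contDiff_atCenter (contDiff_dirD hf eb)).comp (contDiff_fst (F := ℝ × ℝ))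
  have hs : ContDiff ℝ ∞ (fun t : ℝ × ℝ × ℝ => f t - (f (t.1, 0, 0) +
      t.2.1 * dirD ex f (t.1, 0, 0) + t.2.2 * dirD eb f (t.1, 0, 0))) :=
    hf.sub ((h0.add ((contDiff_fst.comp contDiff_snd).mul h1)).add
      ((contDiff_snd.comp contDiff_snd).mul h2))
  refine ThinO.of_partial hB (hs.differentiable (by simp)) (fun s _ => by simp) ?_ ?_
    (taylor_one hB (contDiff_dirD hf ex)) (taylor_one hB (contDiff_dirD hf eb))
  · intro s x β
    have := (hasDerivAt_slot_x hfd s x β).sub ((((hasDerivAt_id x).mul_const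
      (dirD ex f (s, 0, 0))).const_add (f (s, 0, 0))).add_const (β * dirD eb f (s, 0, 0)))
    exact this.congr_deriv (by simp)
  · intro s x β
    have := (hasDerivAt_slot_b hfd s x β).sub (((hasDerivAt_id β).mul_const
      (dirD eb f (s, 0, 0))).const_add (f (s, 0, 0) + x * dirD ex f (s, 0, 0)))
    exact this.congr_deriv (by simp)

theorem taylor_three (hB : ContinuousOn B (Icc c d)) (hf : ContDiff ℝ ∞ f) :
    ThinO c d B 3 (fun t => f t - (f (t.1, 0, 0) + t.2.1 * dirD ex f (t.1, 0, 0)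
      + t.2.2 * dirD eb f (t.1, 0, 0) + t.2.1 ^ 2 * (dirD ex (dirD ex f) (t.1, 0, 0) / 2)
      + t.2.1 * t.2.2 * dirD ex (dirD eb f) (t.1, 0, 0)
      + t.2.2 ^ 2 * (dirD eb (dirD eb f) (t.1, 0, 0) / 2))) := by
  have hfd : Differentiable ℝ f := hf.differentiable (by simp)
  have h0 := (contDiff_atCenter hf).comp (contDiff_fst (F := ℝ × ℝ))
  have h1 := (contDiff_atCenter (contDiff_dirD hf ex)).comp (contDiff_fst (F := ℝ × ℝ))
  have h2 := (contDiff_atCenter (contDiff_dirD hf eb)).comp (contDiff_fst (F := ℝ × ℝ))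
  have h11 := (contDiff_atCenter (contDiff_dirD (contDiff_dirD hf ex) ex)).comp
    (contDiff_fst (F := ℝ × ℝ))
  have h12 := (contDiff_atCenter (contDiff_dirD (contDiff_dirD hf eb) ex)).comp
    (contDiff_fst (F := ℝ × ℝ))
  have h22 := (contDiff_atCenter (contDiff_dirD (contDiff_dirD hf eb) eb)).comp
    (contDiff_fst (F := ℝ × ℝ))
  have px : ContDiff ℝ ∞ (fun t : ℝ × ℝ × ℝ => t.2.1) := contDiff_fst.comp contDiff_snd
  have pb : ContDiff ℝ ∞ (fun t : ℝ × ℝ × ℝ => t.2.2) := contDiff_snd.comp contDiff_snd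
  have hs : ContDiff ℝ ∞ (fun t : ℝ × ℝ × ℝ => f t - (f (t.1, 0, 0) +
      t.2.1 * dirD ex f (t.1, 0, 0) + t.2.2 * dirD eb f (t.1, 0, 0)
      + t.2.1 ^ 2 * (dirD ex (dirD ex f) (t.1, 0, 0) / 2)
      + t.2.1 * t.2.2 * dirD ex (dirD eb f) (t.1, 0, 0)
      + t.2.2 ^ 2 * (dirD eb (dirD eb f) (t.1, 0, 0) / 2))) :=
    hf.sub (((((h0.add (px.mul h1)).add (pb.mul h2)).add ((px.pow 2).mul (h11.div_const 2))).add
      ((px.mul pb).mul h12)).add ((pb.pow 2).mul (h22.div_const 2)))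
  refine ThinO.of_partial hB (hs.differentiable (by simp)) (fun s _ => by simp) ?_ ?_
    (taylor_two hB (contDiff_dirD hf ex)) (taylor_two hB (contDiff_dirD hf eb))
  · intro s x β
    have := (hasDerivAt_slot_x hfd s x β).sub ((((((hasDerivAt_id x).mul_const
      (dirD ex f (s, 0, 0))).const_add (f (s, 0, 0))).add_const (β * dirD eb f (s, 0, 0))).add
      (((hasDerivAt_id x).pow 2).mul_const (dirD ex (dirD ex f) (s, 0, 0) / 2))).add
      ((((hasDerivAt_id x).mul_const β).mul_const (dirD ex (dirD eb f) (s, 0, 0)))) |>.add_const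
      (β ^ 2 * (dirD eb (dirD eb f) (s, 0, 0) / 2)))
    refine this.congr_deriv ?_
    rw [dirD_comm hf ex eb]
    simp
    ring
  · intro s x β
    have := (hasDerivAt_slot_b hfd s x β).sub (((((hasDerivAt_id β).mul_const
      (dirD eb f (s, 0, 0))).const_add (f (s, 0, 0) + x * dirD ex f (s, 0, 0))).add_const
      (x ^ 2 * (dirD ex (dirD ex f) (s, 0, 0) / 2))).add
      (((hasDerivAt_id β).const_mul x).mul_const (dirD ex (dirD eb f) (s, 0, 0))) |>.add
      (((hasDerivAt_id β).pow 2).mul_const (dirD eb (dirD eb f) (s, 0, 0) / 2)))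
    refine this.congr_deriv ?_
    simp
    ring

end Taylor

/-! ### Topology of the strips and integration over them -/

section Strip

variable {c d : ℝ} {B : ℝ → ℝ} {β : ℝ}

theorem mem_stripDomain {u : ℝ × ℝ} :
    u ∈ stripDomain c d B β ↔ u.1 ∈ Icc c d ∧ |u.2| ≤ β * B u.1 := by
  rw [abs_le]; rfl

theorem stripDomain_mono {β' : ℝ} (hB : ∀ s ∈ Icc c d, 0 < B s) (h : β ≤ β') :
    stripDomain c d B β ⊆ stripDomain c d B β' := by
  intro u hu
  rw [mem_stripDomain] at hu ⊢
  exact ⟨hu.1, hu.2.trans (mul_le_mul_of_nonneg_right h (hB _ hu.1).le)⟩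

theorem center_mem_stripDomain (hB : ∀ s ∈ Icc c d, 0 < B s) (hβ : 0 ≤ β) {s : ℝ}
    (hs : s ∈ Icc c d) : (s, (0 : ℝ)) ∈ stripDomain c d B β := by
  rw [mem_stripDomain]
  exact ⟨hs, by simpa using mul_nonneg hβ (hB s hs).le⟩

theorem stripDomain_eq_image (hB : ∀ s ∈ Icc c d, 0 < B s) (hβ : 0 < β) :
    stripDomain c d B β =
      (fun u : ℝ × ℝ => (u.1, β * B u.1 * u.2)) '' (Icc c d ×ˢ Icc (-1) 1) := by
  ext u
  constructor
  · intro hu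
    have hpos : 0 < β * B u.1 := mul_pos hβ (hB _ hu.1)
    refine ⟨(u.1, u.2 / (β * B u.1)), ⟨hu.1, ?_, ?_⟩, ?_⟩
    · rw [le_div_iff₀ hpos]; linarith [hu.2.1]
    · rw [div_le_one hpos]; exact hu.2.2
    · ext
      · rfl
      · exact mul_div_cancel₀ _ hpos.ne'
  · rintro ⟨v, ⟨hv1, hv2⟩, rfl⟩
    have hpos : 0 < β * B v.1 := mul_pos hβ (hB _ hv1)
    refine ⟨hv1, ?_, ?_⟩
    · have := hv2.1; simp only; nlinarith
    · have := hv2.2; simp only; nlinarith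

theorem continuousOn_stripParam (hBc : ContinuousOn B (Icc c d)) :
    ContinuousOn (fun u : ℝ × ℝ => (u.1, β * B u.1 * u.2)) (Icc c d ×ˢ Icc (-1) 1) := by
  refine continuousOn_fst.prodMk ((continuousOn_const.mul
    (hBc.comp continuousOn_fst fun u hu => hu.1)).mul continuousOn_snd)

theorem isCompact_stripDomain (hBc : ContinuousOn B (Icc c d)) (hB : ∀ s ∈ Icc c d, 0 < B s)
    (hβ : 0 < β) : IsCompact (stripDomain c d B β) := by
  rw [stripDomain_eq_image hB hβ]
  exact (isCompact_Icc.prod isCompact_Icc).image_of_continuousOn (continuousOn_stripParam hBc)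

/-- Every point of a closed strip is a limit of points of its interior. -/
theorem stripDomain_subset_closure (hcd : c < d) (hBc : ContinuousOn B (Icc c d))
    (hB : ∀ s ∈ Icc c d, 0 < B s) (hβ : 0 < β) :
    stripDomain c d B β ⊆ closure {u : ℝ × ℝ | u.1 ∈ Ioo c d ∧ |u.2| < β * B u.1} := by
  rw [stripDomain_eq_image hB hβ]
  have hcl : closure (Ioo c d ×ˢ Ioo (-1 : ℝ) 1) = Icc c d ×ˢ Icc (-1) 1 := by
    rw [closure_prod_eq, closure_Ioo hcd.ne, closure_Ioo (by norm_num)]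
  rw [← hcl]
  refine (ContinuousOn.image_closure ?_).trans (closure_mono ?_)
  · rw [hcl]; exact continuousOn_stripParam hBc
  · rintro _ ⟨v, ⟨hv1, hv2⟩, rfl⟩
    have hpos : 0 < β * B v.1 := mul_pos hβ (hB _ (Ioo_subset_Icc_self hv1))
    refine ⟨hv1, ?_⟩
    have : |v.2| < 1 := abs_lt.2 hv2
    simp only [abs_mul, abs_of_pos hpos]
    have e : |β| * |B v.1| = β * B v.1 := by rw [← abs_mul, abs_of_pos hpos]
    nlinarith

theorem isOpen_stripInterior (hBc : ContinuousOn B (Icc c d)) :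
    IsOpen {u : ℝ × ℝ | u.1 ∈ Ioo c d ∧ |u.2| < β * B u.1} := by
  rw [isOpen_iff_mem_nhds]
  rintro u ⟨hu1, hu2⟩
  have h1 : ∀ᶠ v : ℝ × ℝ in 𝓝 u, v.1 ∈ Ioo c d :=
    continuous_fst.continuousAt.eventually_mem (isOpen_Ioo.mem_nhds hu1)
  have hBu : ContinuousAt (fun v : ℝ × ℝ => B v.1) u :=
    ContinuousAt.comp (f := Prod.fst) (hBc.continuousAt (Icc_mem_nhds hu1.1 hu1.2))
      continuous_fst.continuousAt
  have h2 : ∀ᶠ v : ℝ × ℝ in 𝓝 u, |v.2| < β * B v.1 :=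
    ContinuousAt.eventually_lt continuous_snd.abs.continuousAt (hBu.const_mul β) hu2
  filter_upwards [h1, h2] with v hv1 hv2 using ⟨hv1, hv2⟩

theorem setIntegral_stripDomain (hcd : c < d) (hBc : ContinuousOn B (Icc c d))
    (hB : ∀ s ∈ Icc c d, 0 < B s) (hβ : 0 < β) {f : ℝ × ℝ → ℝ}
    (hf : ContinuousOn f (stripDomain c d B β)) :
    ∫ u in stripDomain c d B β, f u =
      ∫ s in c..d, ∫ x in (-(β * B s))..(β * B s), f (s, x) := by
  have hK := isCompact_stripDomain hBc hB hβ
  have hm := hK.measurableSet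
  have hint : Integrable ((stripDomain c d B β).indicator f) (volume.prod volume) :=
    (hf.integrableOn_compact hK).integrable_indicator hm
  rw [← integral_indicator hm, Measure.volume_eq_prod, integral_prod _ hint,
    intervalIntegral.integral_of_le hcd.le, ← integral_Icc_eq_integral_Ioc,
    ← integral_indicator measurableSet_Icc]
  congr 1
  funext s
  by_cases hs : s ∈ Icc c d
  · have hpos : 0 < β * B s := mul_pos hβ (hB s hs)
    rw [indicator_of_mem hs, intervalIntegral.integral_of_le (by linarith),
      ← integral_Icc_eq_integral_Ioc, ← integral_indicator measurableSet_Icc]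
    congr 1
    funext x
    by_cases hx : x ∈ Icc (-(β * B s)) (β * B s)
    · rw [indicator_of_mem hx, indicator_of_mem (show (s, x) ∈ stripDomain c d B β from ⟨hs, hx⟩)]
    · rw [indicator_of_notMem hx, indicator_of_notMem fun h => hx h.2]
  · rw [indicator_of_notMem hs]
    have : (fun x => (stripDomain c d B β).indicator f (s, x)) = fun _ => 0 := by
      funext x
      exact indicator_of_notMem (fun h => hs h.1) _
    rw [this, integral_zero]

/-- Integration gains one order because the area of the strip is `O(β)`. -/
theorem exists_abs_setIntegral_stripDomain_le (hcd : c < d) (hBc : ContinuousOn B (Icc c d))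
    {m : ℕ} {f : ℝ × ℝ × ℝ → ℝ} (hf : ThinO c d B m f) :
    ∃ K : ℝ, ∀ β ∈ Ioc (0 : ℝ) 1,
      |∫ u in stripDomain c d B β, f (u.1, u.2, β)| ≤ K * β ^ (m + 1) := by
  obtain ⟨M, hM0, hM⟩ := exists_bound_breadth hBc
  obtain ⟨K, hK0, hK⟩ := hf.exists_nonneg
  refine ⟨K * ((d - c) * (2 * M)), fun β hβ => ?_⟩
  have hsub : stripDomain c d B β ⊆ Icc c d ×ˢ Icc (-(β * M)) (β * M) := by
    intro u hu
    have := mul_le_mul_of_nonneg_left (hM u.1 hu.1) hβ.1.le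
    exact ⟨hu.1, by linarith [hu.2.1], by linarith [hu.2.2]⟩
  have hbox : volume (Icc c d ×ˢ Icc (-(β * M)) (β * M)) =
      ENNReal.ofReal ((d - c) * (β * M + β * M)) := by
    rw [Measure.volume_eq_prod, Measure.prod_prod, Real.volume_Icc, Real.volume_Icc,
      ← ENNReal.ofReal_mul (by linarith), sub_neg_eq_add]
  have hfin : volume (stripDomain c d B β) < ⊤ :=
    (measure_mono hsub).trans_lt (by rw [hbox]; exact ENNReal.ofReal_lt_top)
  have hvol : volume.real (stripDomain c d B β) ≤ (d - c) * (β * M + β * M) := by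
    have h0 : 0 ≤ (d - c) * (β * M + β * M) := by
      have := hβ.1
      have : 0 < d - c := by linarith
      positivity
    refine ENNReal.toReal_le_of_le_ofReal h0 ((measure_mono hsub).trans hbox.le)
  have hb := norm_setIntegral_le_of_norm_le_const hfin (C := K * β ^ m)
    (f := fun u : ℝ × ℝ => f (u.1, u.2, β)) (fun u hu => hK (u.1, u.2, β) ⟨hβ, hu⟩)
  rw [Real.norm_eq_abs] at hb
  refine hb.trans ((mul_le_mul_of_nonneg_left hvol
    (mul_nonneg hK0 (pow_nonneg hβ.1.le m))).trans (le_of_eq ?_))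
  ring

theorem integral_symm_cubic (r q₀ q₁ q₂ q₃ : ℝ) :
    ∫ x in (-r)..r, (q₀ + q₁ * x + q₂ * x ^ 2 + q₃ * x ^ 3) =
      2 * r * q₀ + 2 / 3 * r ^ 3 * q₂ := by
  have hd : ∀ x ∈ uIcc (-r) r, HasDerivAt
      (fun x : ℝ => q₀ * x + q₁ * (x ^ 2 / 2) + q₂ * (x ^ 3 / 3) + q₃ * (x ^ 4 / 4))
      (q₀ + q₁ * x + q₂ * x ^ 2 + q₃ * x ^ 3) x := by
    intro x _
    have := ((((hasDerivAt_id x).const_mul q₀).add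
      (((hasDerivAt_id x).pow 2).div_const 2 |>.const_mul q₁)).add
      (((hasDerivAt_id x).pow 3).div_const 3 |>.const_mul q₂)).add
      (((hasDerivAt_id x).pow 4).div_const 4 |>.const_mul q₃)
    refine this.congr_deriv ?_
    simp
  rw [intervalIntegral.integral_eq_sub_of_hasDerivAt hd
    (Continuous.intervalIntegrable (by fun_prop) _ _)]
  ring

/-- If the leading part of the integrand is a cubic form in `(x, β)` whose even coefficients are
nonnegative, and the integrals over the strips are of higher order, then the even coefficients
vanish. -/
theorem even_coeff_eq_zero (hcd : c < d) (hBc : ContinuousOn B (Icc c d))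
    (hB : ∀ s ∈ Icc c d, 0 < B s) {p₀ p₁ p₂ p₃ : ℝ → ℝ} (h₀ : Continuous p₀) (h₁ : Continuous p₁)
    (h₂ : Continuous p₂) (h₃ : Continuous p₃) (hn₀ : ∀ s ∈ Icc c d, 0 ≤ p₀ s)
    (hn₂ : ∀ s ∈ Icc c d, 0 ≤ p₂ s) {G : ℝ × ℝ × ℝ → ℝ}
    (hG : ∀ β ∈ Ioc (0 : ℝ) 1,
      IntegrableOn (fun u : ℝ × ℝ => G (u.1, u.2, β)) (stripDomain c d B β))
    (hGP : ThinO c d B 4 fun t => G t - (t.2.2 ^ 3 * p₀ t.1 + t.2.2 ^ 2 * p₁ t.1 * t.2.1 +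
      t.2.2 * p₂ t.1 * t.2.1 ^ 2 + p₃ t.1 * t.2.1 ^ 3)) {K : ℝ}
    (hK : ∀ β ∈ Ioc (0 : ℝ) 1, ∫ u in stripDomain c d B β, G (u.1, u.2, β) ≤ K * β ^ 5) :
    ∀ s ∈ Icc c d, p₀ s = 0 ∧ p₂ s = 0 := by
  obtain ⟨K', hK'⟩ := exists_abs_setIntegral_stripDomain_le hcd hBc hGP
  -- The integral of the cubic form over `|x| ≤ β B(s)` is `β⁴ q(s)`: the odd powers of `x` cancel,
  -- the others contribute the second and fourth power of the breadth with matching powers of `β`.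
  set q : ℝ → ℝ := fun s => 2 * B s * p₀ s + 2 / 3 * B s ^ 3 * p₂ s with hq
  have hqc : ContinuousOn q (Icc c d) :=
    ((hBc.const_mul 2).mul h₀.continuousOn |>.congr fun s _ => by simp).add
      (((hBc.pow 3).const_mul (2 / 3)).mul h₂.continuousOn |>.congr fun s _ => by simp)
  have hP : ∀ β ∈ Ioc (0 : ℝ) 1, ∫ u in stripDomain c d B β, (β ^ 3 * p₀ u.1 +
      β ^ 2 * p₁ u.1 * u.2 + β * p₂ u.1 * u.2 ^ 2 + p₃ u.1 * u.2 ^ 3) =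
      β ^ 4 * ∫ s in c..d, q s := by
    intro β hβ
    rw [setIntegral_stripDomain hcd hBc hB hβ.1 (Continuous.continuousOn (by fun_prop)),
      ← intervalIntegral.integral_const_mul]
    congr 1
    funext s
    simp only
    rw [integral_symm_cubic]
    simp only [hq]
    ring
  -- Both the error term and the assumed bound are `O(β⁵)`, so dividing by `β⁴` leaves an upper
  -- bound that tends to zero.
  have hmain : ∀ β ∈ Ioc (0 : ℝ) 1, ∫ s in c..d, q s ≤ (K + K') * β := by
    intro β hβ
    have hKβ := isCompact_stripDomain hBc hB hβ.1
    have hi : IntegrableOn (fun u : ℝ × ℝ => β ^ 3 * p₀ u.1 + β ^ 2 * p₁ u.1 * u.2 +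
        β * p₂ u.1 * u.2 ^ 2 + p₃ u.1 * u.2 ^ 3) (stripDomain c d B β) :=
      (Continuous.continuousOn (by fun_prop)).integrableOn_compact hKβ
    have h1 := hK' β hβ
    simp only at h1
    rw [integral_sub (hG β hβ) hi, hP β hβ] at h1
    have h2 := (abs_le.1 h1).1
    have h3 := hK β hβ
    have h4 : β ^ 4 * ∫ s in c..d, q s ≤ β ^ 4 * ((K + K') * β) := by
      have : β ^ 4 * ((K + K') * β) = K * β ^ 5 + K' * β ^ (4 + 1) := by ring
      linarith
    exact le_of_mul_le_mul_left h4 (pow_pos hβ.1 4)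
  have hle : ∫ s in c..d, q s ≤ 0 := by
    have ht : Tendsto (fun β : ℝ => (K + K') * β) (𝓝[>] 0) (𝓝 0) := by
      have : Tendsto (fun β : ℝ => (K + K') * β) (𝓝 0) (𝓝 ((K + K') * 0)) :=
        (continuous_const_mul (K + K')).tendsto 0
      rw [mul_zero] at this
      exact this.mono_left nhdsWithin_le_nhds
    refine ge_of_tendsto ht ?_
    filter_upwards [Ioc_mem_nhdsGT (one_pos)] with β hβ using hmain β hβ
  have hnn : ∀ s ∈ Icc c d, 0 ≤ 2 * B s * p₀ s ∧ 0 ≤ 2 / 3 * B s ^ 3 * p₂ s := by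
    intro s hs
    have := hB s hs
    have := hn₀ s hs
    have := hn₂ s hs
    constructor <;> positivity
  intro s hs
  have hq0 : q s = 0 := by
    by_contra hne
    have hpos : 0 < q s := lt_of_le_of_ne (add_nonneg (hnn s hs).1 (hnn s hs).2) (Ne.symm hne)
    have := intervalIntegral.integral_pos hcd hqc
      (fun x hx => add_nonneg (hnn x (Ioc_subset_Icc_self hx)).1 (hnn x (Ioc_subset_Icc_self hx)).2)
      ⟨s, hs, hpos⟩
    linarith
  have hb := hB s hs
  obtain ⟨ha, hb'⟩ := hnn s hs
  have e1 : 2 * B s * p₀ s = 0 := by simp only [hq] at hq0; linarith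
  have e2 : 2 / 3 * B s ^ 3 * p₂ s = 0 := by simp only [hq] at hq0; linarith
  constructor
  · rcases mul_eq_zero.1 e1 with h | h
    · linarith
    · exact h
  · rcases mul_eq_zero.1 e2 with h | h
    · have : 0 < 2 / 3 * B s ^ 3 := by positivity
      linarith
    · exact h

end Strip

/-! ### Stability of embeddings under small perturbations -/

section Embedding

variable {k : ℕ∞}

theorem differentiable_of_contDiff {F : Type*} [NormedAddCommGroup F] [NormedSpace ℝ F]
    (hk : 1 ≤ k) {f : ℝ × ℝ → F} (hf : ContDiff ℝ k f) : Differentiable ℝ f :=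
  (hf.of_le (m := 1) (by exact_mod_cast hk)).differentiable (by simp)

theorem continuous_pd {F : Type*} [NormedAddCommGroup F] [NormedSpace ℝ F]
    (hk : 1 ≤ k) {f : ℝ × ℝ → F} (hf : ContDiff ℝ k f) (i : Fin 2) : Continuous (pd i f) := by
  have : Continuous (fderiv ℝ f) :=
    (hf.of_le (m := 1) (by exact_mod_cast hk)).continuous_fderiv (by simp)
  exact this.clm_apply continuous_const

theorem pd_add_smul {F : Type*} [NormedAddCommGroup F] [NormedSpace ℝ F] {p η : ℝ × ℝ → F}
    (hp : Differentiable ℝ p) (hη : Differentiable ℝ η) (ε : ℝ) (i : Fin 2) (u : ℝ × ℝ) :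
    pd i (fun u => p u + ε • η u) u = pd i p u + ε • pd i η u := by
  have := (hp u).hasFDerivAt.add ((hη u).hasFDerivAt.const_smul ε)
  unfold pd
  rw [show (fun u => p u + ε • η u) = p + ε • η from rfl, this.fderiv]
  simp

theorem fderiv_eq_pd {F : Type*} [NormedAddCommGroup F] [NormedSpace ℝ F] (f : ℝ × ℝ → F)
    (u v : ℝ × ℝ) : fderiv ℝ f u v = v.1 • pd 0 f u + v.2 • pd 1 f u := by
  unfold pd coordVec
  rw [← map_smul, ← map_smul, ← map_add]
  simp

theorem continuous_det2 {X : Type*} [TopologicalSpace X] {f g : X → Plane} (hf : Continuous f)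
    (hg : Continuous g) : Continuous fun x => det2 (f x) (g x) := by
  unfold det2
  fun_prop

/-- Near a point where the derivative of `p` is injective, small `C¹` perturbations of `p` are
injective. -/
theorem eventually_injective_perturbation {E F : Type*} [NormedAddCommGroup E] [NormedSpace ℝ E]
    [FiniteDimensional ℝ E] [NormedAddCommGroup F] [NormedSpace ℝ F] {p η : E → F} {x : E}
    {p' η' : E →L[ℝ] F} (hp : HasStrictFDerivAt p p' x) (hη : HasStrictFDerivAt η η' x)
    (hinj : LinearMap.ker (p' : E →ₗ[ℝ] F) = ⊥) :
    ∀ᶠ z : ℝ × E × E in 𝓝 (0, x, x),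
      p z.2.1 + z.1 • η z.2.1 = p z.2.2 + z.1 • η z.2.2 → z.2.1 = z.2.2 := by
  obtain ⟨K, hK, hanti⟩ := LinearMap.exists_antilipschitzWith (p' : E →ₗ[ℝ] F) hinj
  have hK0 : (0 : ℝ) < K := hK
  obtain ⟨L, hL⟩ := hη.isBigO_sub.bound
  have h1 := hp.isLittleO.bound (show 0 < 1 / (4 * (K : ℝ)) by positivity)
  have hsnd : Tendsto (fun z : ℝ × E × E => z.2) (𝓝 (0, x, x)) (𝓝 (x, x)) :=
    continuous_snd.tendsto _
  have hfst : ∀ᶠ z : ℝ × E × E in 𝓝 (0, x, x), |z.1| * |L| < 1 / (4 * (K : ℝ)) := by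
    have hc : ContinuousAt (fun z : ℝ × E × E => |z.1| * |L|) (0, x, x) := by fun_prop
    exact ContinuousAt.eventually_lt hc continuousAt_const (by simpa using hK0)
  filter_upwards [hsnd.eventually hL, hsnd.eventually h1, hfst] with z hLz h1z hz heq
  by_contra hne
  have hpos : 0 < ‖z.2.1 - z.2.2‖ := norm_pos_iff.2 (sub_ne_zero.2 hne)
  have e1 : p z.2.1 - p z.2.2 = z.1 • (η z.2.2 - η z.2.1) := by
    rw [smul_sub, sub_eq_sub_iff_add_eq_add, heq]; abel
  have e2 : ‖p z.2.1 - p z.2.2‖ ≤ 1 / (4 * (K : ℝ)) * ‖z.2.1 - z.2.2‖ := by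
    rw [e1, norm_smul, norm_sub_rev, Real.norm_eq_abs]
    calc |z.1| * ‖η z.2.1 - η z.2.2‖ ≤ |z.1| * (|L| * ‖z.2.1 - z.2.2‖) := by
          gcongr
          exact hLz.trans (mul_le_mul_of_nonneg_right (le_abs_self L) hpos.le)
      _ = |z.1| * |L| * ‖z.2.1 - z.2.2‖ := by ring
      _ ≤ _ := by gcongr
  have e3 : ‖p' (z.2.1 - z.2.2)‖ ≤ 1 / (2 * (K : ℝ)) * ‖z.2.1 - z.2.2‖ := by
    have := norm_sub_le (p z.2.1 - p z.2.2) (p z.2.1 - p z.2.2 - p' (z.2.1 - z.2.2))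
    rw [sub_sub_cancel] at this
    refine this.trans ((add_le_add e2 h1z).trans (le_of_eq ?_))
    field_simp
    ring
  have e4 : ‖z.2.1 - z.2.2‖ ≤ K * ‖p' (z.2.1 - z.2.2)‖ := by
    have := hanti.le_mul_dist z.2.1 z.2.2
    rw [dist_eq_norm, dist_eq_norm] at this
    simpa only [ContinuousLinearMap.coe_coe, map_sub] using this
  have e5 : K * (1 / (2 * (K : ℝ)) * ‖z.2.1 - z.2.2‖) = ‖z.2.1 - z.2.2‖ / 2 := by field_simp
  have := e4.trans (mul_le_mul_of_nonneg_left e3 hK0.le)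
  linarith

/-- This makes every `η` an admissible two-sided variation. Injectivity is checked near each pair in
`K × K`: off the diagonal the images are separated by continuity, on it the derivative is
invertible. Compactness then yields one range of `ε` for all pairs. -/
theorem IsOrientedEmbedding.eventually_add_smul (hk : 1 ≤ k) {K : Set (ℝ × ℝ)} (hK : IsCompact K)
    {p η : ℝ × ℝ → Plane} (hp : IsOrientedEmbedding k K p) (hη : ContDiff ℝ k η) :
    ∀ᶠ ε in 𝓝 (0 : ℝ), IsOrientedEmbedding k K fun u => p u + ε • η u := by
  have hpd := differentiable_of_contDiff hk hp.contDiff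
  have hηd := differentiable_of_contDiff hk hη
  have hpc := hpd.continuous
  have hηc := hηd.continuous
  have hker : ∀ x ∈ K, LinearMap.ker (fderiv ℝ p x : ℝ × ℝ →ₗ[ℝ] Plane) = ⊥ := by
    intro x hx
    refine LinearMap.ker_eq_bot'.2 fun v hv => ?_
    rw [ContinuousLinearMap.coe_coe, fderiv_eq_pd] at hv
    have hdet := hp.orientation x hx
    have c0 := congrArg (fun w : Plane => w 0) hv
    have c1 := congrArg (fun w : Plane => w 1) hv
    simp only [PiLp.add_apply, PiLp.smul_apply, smul_eq_mul, PiLp.zero_apply] at c0 c1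
    unfold det2 at hdet
    have k1 : v.1 * (pd 0 p x 0 * pd 1 p x 1 - pd 0 p x 1 * pd 1 p x 0) = 0 := by
      linear_combination pd 1 p x 1 * c0 - pd 1 p x 0 * c1
    have k2 : v.2 * (pd 0 p x 0 * pd 1 p x 1 - pd 0 p x 1 * pd 1 p x 0) = 0 := by
      linear_combination -pd 0 p x 1 * c0 + pd 0 p x 0 * c1
    exact Prod.ext ((mul_eq_zero.1 k1).resolve_right hdet.ne')
      ((mul_eq_zero.1 k2).resolve_right hdet.ne')
  have hinj : ∀ᶠ ε in 𝓝 (0 : ℝ), ∀ z ∈ K ×ˢ K,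
      p z.1 + ε • η z.1 = p z.2 + ε • η z.2 → z.1 = z.2 := by
    refine (hK.prod hK).eventually_forall_of_forall_eventually ?_
    rintro ⟨x, y⟩ ⟨hx, hy⟩
    by_cases hxy : x = y
    · subst hxy
      have h1 : (1 : WithTop ℕ∞) ≤ k := by exact_mod_cast hk
      exact eventually_injective_perturbation
        (hp.contDiff.contDiffAt.hasStrictFDerivAt (by positivity))
        (hη.contDiffAt.hasStrictFDerivAt (by positivity)) (hker x hx)
    · have hne : p x + (0 : ℝ) • η x ≠ p y + (0 : ℝ) • η y := by
        simpa using fun h => hxy (hp.injOn hx hy h)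
      have hc : ContinuousAt (fun z : ℝ × (ℝ × ℝ) × (ℝ × ℝ) =>
          p z.2.1 + z.1 • η z.2.1 - (p z.2.2 + z.1 • η z.2.2)) (0, x, y) := by fun_prop
      filter_upwards [hc.eventually_ne (sub_ne_zero.2 hne)] with z hz h
      exact absurd (sub_eq_zero.2 h) hz
  have hor : ∀ᶠ ε in 𝓝 (0 : ℝ), ∀ u ∈ K,
      0 < det2 (pd 0 p u + ε • pd 0 η u) (pd 1 p u + ε • pd 1 η u) := by
    refine hK.eventually_forall_of_forall_eventually fun u hu => ?_
    have c0 := continuous_pd hk hp.contDiff 0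
    have c1 := continuous_pd hk hp.contDiff 1
    have d0 := continuous_pd hk hη 0
    have d1 := continuous_pd hk hη 1
    have hc : Continuous fun z : ℝ × ℝ × ℝ =>
        det2 (pd 0 p z.2 + z.1 • pd 0 η z.2) (pd 1 p z.2 + z.1 • pd 1 η z.2) :=
      continuous_det2 (by fun_prop) (by fun_prop)
    refine hc.continuousAt.eventually_const_lt ?_
    simpa using hp.orientation u hu
  filter_upwards [hinj, hor] with ε h1 h2
  refine ⟨hp.contDiff.add (hη.const_smul ε), fun x hx y hy h => h1 (x, y) ⟨hx, hy⟩ h, ?_⟩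
  intro u hu
  rw [pd_add_smul hpd hηd, pd_add_smul hpd hηd]
  exact h2 u hu

end Embedding

/-! ### The stiffness form and the first variation of the energy -/

section Stiffness

variable {S : CenteredStrip} {C : StiffnessField} {lam mu β : ℝ}

theorem CenteredStrip.D_subset (S : CenteredStrip) (hβ : β ≤ 1) : S.D β ⊆ S.D 1 :=
  stripDomain_mono S.B_pos hβ

theorem CenteredStrip.isCompact_D (S : CenteredStrip) (hβ : 0 < β) : IsCompact (S.D β) :=
  isCompact_stripDomain S.B_continuousOn S.B_pos hβ

theorem CenteredStrip.continuous_g (S : CenteredStrip) : Continuous S.g :=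
  continuous_matrix fun i j => (S.g_smooth i j).continuous

theorem CenteredStrip.det_pos (S : CenteredStrip) {u : ℝ × ℝ} (hu : u ∈ S.D 1) :
    0 < (S.g u).det := (S.g_posDef u hu).det_pos

theorem CenteredStrip.continuousOn_inv (S : CenteredStrip) (i j : Fin 2) :
    ContinuousOn (fun u => (S.g u)⁻¹ i j) (S.D 1) := by
  have h1 : ContinuousOn (fun u => ((S.g u).det)⁻¹) (S.D 1) :=
    S.continuous_g.matrix_det.continuousOn.inv₀ fun u hu => (S.det_pos hu).ne'
  have h2 : Continuous fun u => (S.g u).adjugate i j :=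
    S.continuous_g.matrix_adjugate.matrix_elem i j
  refine (h1.mul h2.continuousOn).congr fun u _ => ?_
  rw [Matrix.inv_def, Ring.inverse_eq_inv']
  rfl

theorem StiffnessField.IsIsotropic.continuousOn (hC : C.IsIsotropic S lam mu) (i j k l : Fin 2) :
    ContinuousOn (fun u => C u i j k l) (S.D 1) := by
  have h := S.continuousOn_inv
  refine ContinuousOn.congr ?_ fun u hu => hC u hu i j k l
  exact (((h i j).mul (h k l)).const_mul lam).add
    ((((h i k).mul (h j l)).add ((h i l).mul (h j k))).const_mul mu)

theorem StiffnessField.IsIsotropic.continuousOn_pair (hC : C.IsIsotropic S lam mu) (hβ : β ≤ 1)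
    {X Y : ℝ × ℝ → Matrix (Fin 2) (Fin 2) ℝ} (hX : Continuous X) (hY : Continuous Y) :
    ContinuousOn (fun u => C.pair u (X u) (Y u) * Real.sqrt (S.g u).det) (S.D β) := by
  refine ContinuousOn.mul ?_ S.continuous_g.matrix_det.sqrt.continuousOn
  unfold StiffnessField.pair
  refine continuousOn_finsetSum _ fun i _ => continuousOn_finsetSum _ fun j _ =>
    continuousOn_finsetSum _ fun k _ => continuousOn_finsetSum _ fun l _ => ?_
  exact (((hC.continuousOn i j k l).mono (S.D_subset hβ)).mul
    (hX.matrix_elem i j).continuousOn).mul (hY.matrix_elem k l).continuousOn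

theorem StiffnessField.pair_add_left (C : StiffnessField) (u : ℝ × ℝ)
    (X X' Y : Matrix (Fin 2) (Fin 2) ℝ) : C.pair u (X + X') Y = C.pair u X Y + C.pair u X' Y := by
  simp only [StiffnessField.pair, Matrix.add_apply, Fin.sum_univ_two]; ring

theorem StiffnessField.pair_add_right (C : StiffnessField) (u : ℝ × ℝ)
    (X Y Y' : Matrix (Fin 2) (Fin 2) ℝ) : C.pair u X (Y + Y') = C.pair u X Y + C.pair u X Y' := by
  simp only [StiffnessField.pair, Matrix.add_apply, Fin.sum_univ_two]; ring

theorem StiffnessField.pair_smul_left (C : StiffnessField) (u : ℝ × ℝ) (r : ℝ)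
    (X Y : Matrix (Fin 2) (Fin 2) ℝ) : C.pair u (r • X) Y = r * C.pair u X Y := by
  simp only [StiffnessField.pair, Matrix.smul_apply, smul_eq_mul, Fin.sum_univ_two]; ring

theorem StiffnessField.pair_smul_right (C : StiffnessField) (u : ℝ × ℝ) (r : ℝ)
    (X Y : Matrix (Fin 2) (Fin 2) ℝ) : C.pair u X (r • Y) = r * C.pair u X Y := by
  simp only [StiffnessField.pair, Matrix.smul_apply, smul_eq_mul, Fin.sum_univ_two]; ring

/-- The first variation of the strain of `p` in the direction `η`. -/
noncomputable def strainVar (p η : ℝ × ℝ → Plane) (u : ℝ × ℝ) : Matrix (Fin 2) (Fin 2) ℝ :=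
  Matrix.of fun i j => (inner ℝ (pd i p u) (pd j η u) + inner ℝ (pd i η u) (pd j p u)) / 2

theorem strain_add_smul {p η : ℝ × ℝ → Plane} (hp : Differentiable ℝ p)
    (hη : Differentiable ℝ η) (ε : ℝ) (u : ℝ × ℝ) :
    strain S (fun u => p u + ε • η u) u =
      strain S p u + ε • strainVar p η u + ε ^ 2 • ((1 / 2 : ℝ) • inducedMetric η u) := by
  ext i j
  simp only [strain, strainVar, inducedMetric, Matrix.add_apply, Matrix.smul_apply,
    Matrix.sub_apply, Matrix.of_apply, smul_eq_mul, pd_add_smul hp hη, inner_add_left,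
    inner_add_right, inner_smul_left, inner_smul_right]
  simp only [conj_trivial]
  ring

variable {k : ℕ∞}

theorem continuous_inducedMetric (hk : 1 ≤ k) {p : ℝ × ℝ → Plane} (hp : ContDiff ℝ k p) :
    Continuous (inducedMetric p) :=
  continuous_matrix fun i j => (continuous_pd hk hp i).inner (continuous_pd hk hp j)

theorem continuous_strain (hk : 1 ≤ k) {p : ℝ × ℝ → Plane} (hp : ContDiff ℝ k p) :
    Continuous (strain S p) :=
  ((continuous_inducedMetric hk hp).sub S.continuous_g).const_smul (1 / 2 : ℝ)

theorem continuous_strainVar (hk : 1 ≤ k) {p η : ℝ × ℝ → Plane} (hp : ContDiff ℝ k p)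
    (hη : ContDiff ℝ k η) : Continuous (strainVar p η) :=
  continuous_matrix fun i j => (((continuous_pd hk hp i).inner (continuous_pd hk hη j)).add
    ((continuous_pd hk hη i).inner (continuous_pd hk hp j))).div_const 2

theorem integral_quartic {α : Type*} [MeasurableSpace α] {μ : Measure α} {f₀ f₁ f₂ f₃ f₄ : α → ℝ}
    (h₀ : Integrable f₀ μ) (h₁ : Integrable f₁ μ) (h₂ : Integrable f₂ μ) (h₃ : Integrable f₃ μ)
    (h₄ : Integrable f₄ μ) (ε : ℝ) :
    ∫ a, (f₀ a + ε * f₁ a + ε ^ 2 * f₂ a + ε ^ 3 * f₃ a + ε ^ 4 * f₄ a) ∂μ =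
      ∫ a, f₀ a ∂μ + ε * ∫ a, f₁ a ∂μ + ε ^ 2 * ∫ a, f₂ a ∂μ + ε ^ 3 * ∫ a, f₃ a ∂μ +
        ε ^ 4 * ∫ a, f₄ a ∂μ := by
  have e₁ : Integrable (fun a => f₀ a + ε * f₁ a) μ := h₀.add (h₁.const_mul ε)
  have e₂ : Integrable (fun a => f₀ a + ε * f₁ a + ε ^ 2 * f₂ a) μ :=
    e₁.add (h₂.const_mul (ε ^ 2))
  have e₃ : Integrable (fun a => f₀ a + ε * f₁ a + ε ^ 2 * f₂ a + ε ^ 3 * f₃ a) μ :=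
    e₂.add (h₃.const_mul (ε ^ 3))
  rw [integral_add e₃ (h₄.const_mul (ε ^ 4)), integral_add e₂ (h₃.const_mul (ε ^ 3)),
    integral_add e₁ (h₂.const_mul (ε ^ 2)), integral_add h₀ (h₁.const_mul ε)]
  simp only [integral_const_mul]

/-- The Euler–Lagrange equation of the strain energy in weak form. -/
theorem IsEnergyMinimizer.firstVariation (hC : C.IsIsotropic S lam mu) (hk : 1 ≤ k)
    (hβ : β ∈ Ioc (0 : ℝ) 1) {p : ℝ × ℝ → Plane} (hp : IsEnergyMinimizer S C k β p)
    {η : ℝ × ℝ → Plane} (hη : ContDiff ℝ k η) :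
    ∫ u in S.D β, (C.pair u (strain S p u) (strainVar p η u) +
      C.pair u (strainVar p η u) (strain S p u)) * Real.sqrt (S.g u).det = 0 := by
  have hK := S.isCompact_D hβ.1
  have hpc := hp.embedding.contDiff
  have hX : Continuous (strain S p) := continuous_strain hk hpc
  have hY : Continuous (strainVar p η) := continuous_strainVar hk hpc hη
  have hZ : Continuous fun u => (1 / 2 : ℝ) • inducedMetric η u :=
    (continuous_inducedMetric hk hη).const_smul (1 / 2 : ℝ)
  set X := strain S p
  set Y := strainVar p η
  set Z := fun u => (1 / 2 : ℝ) • inducedMetric η u with hZdef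
  let I := fun (X Y : ℝ × ℝ → Matrix (Fin 2) (Fin 2) ℝ) =>
    ∫ u in S.D β, C.pair u (X u) (Y u) * Real.sqrt (S.g u).det
  have hint : ∀ {X Y : ℝ × ℝ → Matrix (Fin 2) (Fin 2) ℝ}, Continuous X → Continuous Y →
      IntegrableOn (fun u => C.pair u (X u) (Y u) * Real.sqrt (S.g u).det) (S.D β) :=
    fun hX hY => (hC.continuousOn_pair hβ.2 hX hY).integrableOn_compact hK
  -- The strain is quadratic in `ε`, so the energy is a quartic polynomial and no differentiation
  -- under the integral sign is needed. Both `I X Y` and `I Y X` are kept, so no symmetry of the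
  -- pairing has to be invoked.
  have hexp : ∀ ε : ℝ, energy S C β (fun u => p u + ε • η u) =
      1 / 2 * (I X X + ε * (I X Y + I Y X) + ε ^ 2 * (I X Z + I Z X + I Y Y) +
        ε ^ 3 * (I Y Z + I Z Y) + ε ^ 4 * I Z Z) := by
    intro ε
    have e : energy S C β (fun u => p u + ε • η u) = ∫ u in S.D β,
        1 / 2 * (C.pair u (X u) (X u) * Real.sqrt (S.g u).det +
        ε * (C.pair u (X u) (Y u) * Real.sqrt (S.g u).det +
          C.pair u (Y u) (X u) * Real.sqrt (S.g u).det) +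
        ε ^ 2 * (C.pair u (X u) (Z u) * Real.sqrt (S.g u).det +
          C.pair u (Z u) (X u) * Real.sqrt (S.g u).det +
          C.pair u (Y u) (Y u) * Real.sqrt (S.g u).det) +
        ε ^ 3 * (C.pair u (Y u) (Z u) * Real.sqrt (S.g u).det +
          C.pair u (Z u) (Y u) * Real.sqrt (S.g u).det) +
        ε ^ 4 * (C.pair u (Z u) (Z u) * Real.sqrt (S.g u).det)) := by
      unfold energy
      congr 1
      funext u
      rw [strain_add_smul (differentiable_of_contDiff hk hpc) (differentiable_of_contDiff hk hη)]
      change 1 / 2 * C.pair u (X u + ε • Y u + ε ^ 2 • Z u) (X u + ε • Y u + ε ^ 2 • Z u) * _ = _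
      simp only [StiffnessField.pair_add_left, StiffnessField.pair_add_right,
        StiffnessField.pair_smul_left, StiffnessField.pair_smul_right]
      ring
    have iXX := hint hX hX
    have i1 : IntegrableOn (fun u => C.pair u (X u) (Y u) * Real.sqrt (S.g u).det +
        C.pair u (Y u) (X u) * Real.sqrt (S.g u).det) (S.D β) := (hint hX hY).add (hint hY hX)
    have i2 : IntegrableOn (fun u => C.pair u (X u) (Z u) * Real.sqrt (S.g u).det +
        C.pair u (Z u) (X u) * Real.sqrt (S.g u).det +
        C.pair u (Y u) (Y u) * Real.sqrt (S.g u).det) (S.D β) :=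
      ((hint hX hZ).add (hint hZ hX)).add (hint hY hY)
    have i5 : IntegrableOn (fun u => C.pair u (X u) (Z u) * Real.sqrt (S.g u).det +
        C.pair u (Z u) (X u) * Real.sqrt (S.g u).det) (S.D β) := (hint hX hZ).add (hint hZ hX)
    have i3 : IntegrableOn (fun u => C.pair u (Y u) (Z u) * Real.sqrt (S.g u).det +
        C.pair u (Z u) (Y u) * Real.sqrt (S.g u).det) (S.D β) := (hint hY hZ).add (hint hZ hY)
    have i4 := hint hZ hZ
    rw [e, integral_const_mul, integral_quartic iXX i1 i2 i3 i4]
    rw [integral_add (hint hX hY) (hint hY hX), integral_add (hint hY hZ) (hint hZ hY),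
      integral_add i5 (hint hY hY), integral_add (hint hX hZ) (hint hZ hX)]
  have hmin : IsLocalMin (fun ε : ℝ => energy S C β (fun u => p u + ε • η u)) 0 := by
    filter_upwards [hp.embedding.eventually_add_smul hk hK hη] with ε hε
    have := hp.minimal _ hε
    simpa using this
  have hder : HasDerivAt (fun ε : ℝ => energy S C β (fun u => p u + ε • η u))
      (1 / 2 * (I X Y + I Y X)) 0 := by
    simp only [hexp]
    have := (((((((hasDerivAt_id (0 : ℝ)).mul_const (I X Y + I Y X)).const_add (I X X)).add
      (((hasDerivAt_id (0 : ℝ)).pow 2).mul_const (I X Z + I Z X + I Y Y))).add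
      (((hasDerivAt_id (0 : ℝ)).pow 3).mul_const (I Y Z + I Z Y))).add
      (((hasDerivAt_id (0 : ℝ)).pow 4).mul_const (I Z Z))).const_mul (1 / 2))
    refine this.congr_deriv ?_
    simp
  have h0 := hmin.hasDerivAt_eq_zero hder
  have hsum : ∫ u in S.D β, (C.pair u (X u) (Y u) + C.pair u (Y u) (X u)) *
      Real.sqrt (S.g u).det = I X Y + I Y X := by
    simp only [add_mul]
    exact integral_add (hint hX hY) (hint hY hX)
  rw [hsum]
  linarith

end Stiffness

/-! ### Replacing the stiffness form by its value on the center curve -/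

section CenterValues

variable {S : CenteredStrip} {C : StiffnessField} {lam mu c d : ℝ} {m n : ℕ}

/-- The quadratic form of the isotropic stiffness tensor in an orthonormal frame. -/
def isoForm (lam mu : ℝ) (X Y : Matrix (Fin 2) (Fin 2) ℝ) : ℝ :=
  lam * ((X 0 0 + X 1 1) * (Y 0 0 + Y 1 1)) +
    mu * (2 * (X 0 0 * Y 0 0) + 2 * (X 1 1 * Y 1 1) + (X 0 1 + X 1 0) * (Y 0 1 + Y 1 0))

/-- The coefficients of the isotropic stiffness tensor in an orthonormal frame. -/
def isoCoeff (lam mu : ℝ) (i j k l : Fin 2) : ℝ :=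
  lam * ((1 : Matrix (Fin 2) (Fin 2) ℝ) i j * (1 : Matrix (Fin 2) (Fin 2) ℝ) k l) +
    mu * ((1 : Matrix (Fin 2) (Fin 2) ℝ) i k * (1 : Matrix (Fin 2) (Fin 2) ℝ) j l +
      (1 : Matrix (Fin 2) (Fin 2) ℝ) i l * (1 : Matrix (Fin 2) (Fin 2) ℝ) j k)

theorem sum_isoCoeff (lam mu : ℝ) (X Y : Matrix (Fin 2) (Fin 2) ℝ) :
    ∑ i, ∑ j, ∑ k, ∑ l, isoCoeff lam mu i j k l * X i j * Y k l = isoForm lam mu X Y := by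
  simp [isoCoeff, isoForm, Fin.sum_univ_two]
  ring

theorem StiffnessField.IsIsotropic.pair_center (hC : C.IsIsotropic S lam mu) {s : ℝ}
    (hs : s ∈ Icc S.a S.b) (X Y : Matrix (Fin 2) (Fin 2) ℝ) :
    C.pair (s, 0) X Y = isoForm lam mu X Y := by
  rw [← sum_isoCoeff]
  unfold StiffnessField.pair
  simp_rw [hC _ (center_mem_stripDomain S.B_pos zero_le_one hs), S.g_center s hs, inv_one]
  rfl

theorem StiffnessField.IsPositive.isoForm_pos (hC : C.IsIsotropic S lam mu)
    (hCpos : C.IsPositive S) {X : Matrix (Fin 2) (Fin 2) ℝ} (hX : X.IsSymm) (h0 : X ≠ 0) :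
    0 < isoForm lam mu X X := by
  have ha : S.a ∈ Icc S.a S.b := left_mem_Icc.2 S.a_lt_b.le
  rw [← hC.pair_center ha]
  exact hCpos _ (center_mem_stripDomain S.B_pos zero_le_one ha) X hX h0

theorem StiffnessField.IsPositive.isoForm_nonneg (hC : C.IsIsotropic S lam mu)
    (hCpos : C.IsPositive S) {X : Matrix (Fin 2) (Fin 2) ℝ} (hX : X.IsSymm) :
    0 ≤ isoForm lam mu X X := by
  by_cases h0 : X = 0
  · simp [h0, isoForm]
  · exact (hCpos.isoForm_pos hC hX h0).le

theorem StiffnessField.IsPositive.eq_zero (hC : C.IsIsotropic S lam mu)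
    (hCpos : C.IsPositive S) {X : Matrix (Fin 2) (Fin 2) ℝ} (hX : X.IsSymm)
    (h : isoForm lam mu X X = 0) : X = 0 := by
  by_contra h0
  exact (hCpos.isoForm_pos hC hX h0).ne' h

theorem CenteredStrip.continuousOn_B (S : CenteredStrip) (hJ : Icc c d ⊆ Icc S.a S.b) :
    ContinuousOn S.B (Icc c d) := S.B_continuousOn.mono hJ

theorem stripDomain_subset_D (hJ : Icc c d ⊆ Icc S.a S.b) {β : ℝ} :
    stripDomain c d S.B β ⊆ S.D β := fun _ hu => ⟨hJ hu.1, hu.2⟩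

theorem thinRegion_mem_D (hJ : Icc c d ⊆ Icc S.a S.b) {t : ℝ × ℝ × ℝ}
    (ht : t ∈ thinRegion c d S.B) : (t.1, t.2.1) ∈ S.D 1 :=
  S.D_subset ht.1.2 (stripDomain_subset_D hJ ht.2)

theorem contDiff_chart {F : Type*} [NormedAddCommGroup F] [NormedSpace ℝ F] {f : ℝ × ℝ → F}
    (hf : ContDiff ℝ ∞ f) : ContDiff ℝ ∞ fun t : ℝ × ℝ × ℝ => f (t.1, t.2.1) :=
  hf.comp (contDiff_fst.prodMk (contDiff_fst.comp contDiff_snd))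

theorem CenteredStrip.smooth_det (S : CenteredStrip) : ContDiff ℝ ∞ fun u => (S.g u).det := by
  simp only [Matrix.det_fin_two]
  exact ((S.g_smooth 0 0).mul (S.g_smooth 1 1)).sub ((S.g_smooth 0 1).mul (S.g_smooth 1 0))

theorem thinO_metric (hJ : Icc c d ⊆ Icc S.a S.b) (i j : Fin 2) :
    ThinO c d S.B 1 fun t => S.g (t.1, t.2.1) i j - (1 : Matrix (Fin 2) (Fin 2) ℝ) i j := by
  refine (taylor_one (S.continuousOn_B hJ) (contDiff_chart (S.g_smooth i j))).congr fun t ht => ?_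
  simp only
  rw [S.g_center _ (hJ ht.2.1)]

theorem thinO_det (hJ : Icc c d ⊆ Icc S.a S.b) :
    ThinO c d S.B 1 fun t => (S.g (t.1, t.2.1)).det - 1 := by
  refine (taylor_one (S.continuousOn_B hJ) (contDiff_chart S.smooth_det)).congr fun t ht => ?_
  simp only
  rw [S.g_center _ (hJ ht.2.1), Matrix.det_one]

theorem thinO_sqrt_det (hJ : Icc c d ⊆ Icc S.a S.b) :
    ThinO c d S.B 1 fun t => Real.sqrt (S.g (t.1, t.2.1)).det - 1 := by
  obtain ⟨K, hK⟩ := thinO_iff.1 (thinO_det hJ)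
  refine thinO_iff.2 ⟨K, fun t ht => le_trans ?_ (hK t ht)⟩
  have hdet := S.det_pos (thinRegion_mem_D hJ ht)
  set D := (S.g (t.1, t.2.1)).det
  have h1 := Real.sqrt_nonneg D
  have h2 : D - 1 = (Real.sqrt D - 1) * (Real.sqrt D + 1) := by
    have := Real.sq_sqrt hdet.le
    linear_combination -this
  rw [h2, abs_mul, abs_of_pos (show 0 < Real.sqrt D + 1 by linarith)]
  nlinarith [abs_nonneg (Real.sqrt D - 1)]

theorem thinO_inv_det (hJ : Icc c d ⊆ Icc S.a S.b) :
    ThinO c d S.B 1 fun t => ((S.g (t.1, t.2.1)).det)⁻¹ - 1 := by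
  obtain ⟨K, hK0, hK⟩ := (thinO_det hJ).exists_nonneg
  -- The minimum of the determinant on the compact domain bounds the denominator away from zero
  -- uniformly.
  obtain ⟨u₀, hu₀, hmin⟩ := (S.isCompact_D one_pos).exists_isMinOn
    ⟨(S.a, 0), center_mem_stripDomain S.B_pos zero_le_one (left_mem_Icc.2 S.a_lt_b.le)⟩
    S.continuous_g.matrix_det.continuousOn
  have hpos := S.det_pos hu₀
  refine thinO_iff.2 ⟨K / (S.g u₀).det, fun t ht => ?_⟩
  have hmem := thinRegion_mem_D hJ ht
  have hdet := S.det_pos hmem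
  have hle : (S.g u₀).det ≤ (S.g (t.1, t.2.1)).det := hmin hmem
  have hb := hK t ht
  set D := (S.g (t.1, t.2.1)).det
  have e : D⁻¹ - 1 = -((D - 1) / D) := by field_simp; ring
  rw [e, abs_neg, abs_div, abs_of_pos hdet, div_mul_eq_mul_div]
  exact div_le_div₀ ((abs_nonneg _).trans hb) hb hpos hle

theorem ThinO.mul_sub_one {f g : ℝ × ℝ × ℝ → ℝ} {a b : ℝ} {B : ℝ → ℝ}
    (hf : ThinO c d B 1 fun t => f t - a) (hg : ThinO c d B 1 fun t => g t - b) :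
    ThinO c d B 1 fun t => f t * g t - a * b := by
  have h1 := (hf.mul_le hg (l := 1) (by norm_num)).add ((hf.const_mul b).add (hg.const_mul a))
  exact h1.congr fun t _ => by ring

theorem thinO_inv (hJ : Icc c d ⊆ Icc S.a S.b) (i j : Fin 2) :
    ThinO c d S.B 1 fun t =>
      (S.g (t.1, t.2.1))⁻¹ i j - (1 : Matrix (Fin 2) (Fin 2) ℝ) i j := by
  have hadj : ThinO c d S.B 1 fun t =>
      (S.g (t.1, t.2.1)).adjugate i j - (1 : Matrix (Fin 2) (Fin 2) ℝ) i j := by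
    have h := thinO_metric (S := S) hJ
    fin_cases i <;> fin_cases j <;>
      simp only [Matrix.adjugate_fin_two, Fin.zero_eta, Fin.mk_one, Matrix.of_apply,
        Matrix.cons_val_zero, Matrix.cons_val_one, Matrix.cons_val']
    · exact (h 1 1).congr fun t _ => by simp
    · exact (h 0 1).neg.congr fun t _ => by simp
    · exact (h 1 0).neg.congr fun t _ => by simp
    · exact (h 0 0).congr fun t _ => by simp
  refine ((thinO_inv_det hJ).mul_sub_one hadj).congr fun t _ => ?_
  rw [Matrix.inv_def, Ring.inverse_eq_inv', Matrix.smul_apply, smul_eq_mul, one_mul]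

theorem thinO_stiffness (hC : C.IsIsotropic S lam mu) (hJ : Icc c d ⊆ Icc S.a S.b)
    (i j k l : Fin 2) : ThinO c d S.B 1 fun t =>
      C (t.1, t.2.1) i j k l * Real.sqrt (S.g (t.1, t.2.1)).det - isoCoeff lam mu i j k l := by
  have h := thinO_inv (S := S) hJ
  have h1 : ThinO c d S.B 1 fun t => C (t.1, t.2.1) i j k l - isoCoeff lam mu i j k l := by
    have := ((h i j).mul_sub_one (h k l)).const_mul lam |>.add
      ((((h i k).mul_sub_one (h j l)).add ((h i l).mul_sub_one (h j k))).const_mul mu)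
    refine this.congr fun t ht => ?_
    rw [hC _ (thinRegion_mem_D hJ ht), isoCoeff]
    ring
  exact (h1.mul_sub_one (thinO_sqrt_det hJ)).congr fun t _ => by ring

/-- To leading order, the stiffness tensor may be evaluated in an orthonormal frame. -/
theorem thinO_pair (hC : C.IsIsotropic S lam mu) (hJ : Icc c d ⊆ Icc S.a S.b)
    {X L Y M : ℝ × ℝ × ℝ → Matrix (Fin 2) (Fin 2) ℝ}
    (hX : ∀ i j, ThinO c d S.B (m + 1) fun t => X t i j - L t i j)
    (hL : ∀ i j, ThinO c d S.B m fun t => L t i j)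
    (hY : ∀ i j, ThinO c d S.B (n + 1) fun t => Y t i j - M t i j)
    (hM : ∀ i j, ThinO c d S.B n fun t => M t i j) :
    ThinO c d S.B (m + n + 1) fun t =>
      C.pair (t.1, t.2.1) (X t) (Y t) * Real.sqrt (S.g (t.1, t.2.1)).det -
        isoForm lam mu (L t) (M t) := by
  have key : ∀ i j k l : Fin 2, ThinO c d S.B (m + n + 1) fun t =>
      C (t.1, t.2.1) i j k l * Real.sqrt (S.g (t.1, t.2.1)).det * X t i j * Y t k l -
        isoCoeff lam mu i j k l * L t i j * M t k l := by
    intro i j k l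
    have hc := thinO_stiffness hC hJ i j k l
    have hX' : ThinO c d S.B m fun t => X t i j :=
      (((hX i j).mono (Nat.le_succ m)).add (hL i j)).congr fun t _ => by ring
    have hY' : ThinO c d S.B n fun t => Y t k l :=
      (((hY k l).mono (Nat.le_succ n)).add (hM k l)).congr fun t _ => by ring
    -- Telescoping, with `c` the weighted coefficient and `c₀` its center value: `cXY - c₀LM = (c -
    -- c₀)XY + c₀(X - L)Y + c₀L(Y - M)`; each difference contributes the additional order.
    have h1 := hc.mul_le (hX'.mul hY') (l := m + n + 1) (by omega)
    have h2 := ((hX i j).mul_le hY' (l := m + n + 1) (by omega)).const_mul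
      (isoCoeff lam mu i j k l)
    have h3 := ((hL i j).mul_le (hY k l) (l := m + n + 1) (by omega)).const_mul
      (isoCoeff lam mu i j k l)
    exact (h1.add (h2.add h3)).congr fun t _ => by ring
  have := ThinO.sum (s := Finset.univ) fun i _ => ThinO.sum (s := Finset.univ) fun j _ =>
    ThinO.sum (s := Finset.univ) fun k _ => ThinO.sum (s := Finset.univ) fun l _ => key i j k l
  refine this.congr fun t _ => ?_
  simp only [Finset.sum_sub_distrib, sum_isoCoeff]
  congr 1
  simp only [StiffnessField.pair, Finset.sum_mul]
  refine Finset.sum_congr rfl fun i _ => Finset.sum_congr rfl fun j _ =>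
    Finset.sum_congr rfl fun k _ => Finset.sum_congr rfl fun l _ => by ring

theorem ThinO.isoForm {L M : ℝ × ℝ × ℝ → Matrix (Fin 2) (Fin 2) ℝ} {B : ℝ → ℝ}
    (hL : ∀ i j, ThinO c d B m fun t => L t i j) (hM : ∀ i j, ThinO c d B n fun t => M t i j) :
    ThinO c d B (m + n) fun t => isoForm lam mu (L t) (M t) := by
  have h1 := (((hL 0 0).add (hL 1 1)).mul ((hM 0 0).add (hM 1 1))).const_mul lam
  have h2 := ((((hL 0 0).mul (hM 0 0)).const_mul 2).add
    (((hL 1 1).mul (hM 1 1)).const_mul 2)).add (((hL 0 1).add (hL 1 0)).mul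
      ((hM 0 1).add (hM 1 0)))
  exact h1.add (h2.const_mul mu)

end CenterValues

/-! ### An upper bound for the minimal energy -/

section EnergyBound

variable {S : CenteredStrip} {C : StiffnessField} {lam mu : ℝ} {k : ℕ∞}

/-- The chart as a map to the plane. -/
noncomputable def chartMap (u : ℝ × ℝ) : Plane := !₂[u.1, u.2]

theorem contDiff_chartMap : ContDiff ℝ ∞ chartMap := by
  rw [contDiff_euclidean]
  intro i
  fin_cases i
  · exact contDiff_fst
  · exact contDiff_snd

theorem pd_chartMap (i : Fin 2) (u : ℝ × ℝ) : pd i chartMap u = chartMap (coordVec i) := by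
  have hl : IsBoundedLinearMap ℝ chartMap := by
    refine (LinearMap.toContinuousLinearMap
      ({ toFun := chartMap, map_add' := ?_, map_smul' := ?_ } : ℝ × ℝ →ₗ[ℝ] Plane)).isBoundedLinearMap
    · intro x y; ext i; fin_cases i <;> simp [chartMap]
    · intro r x; ext i; fin_cases i <;> simp [chartMap]
  unfold pd
  rw [hl.fderiv]
  rfl

theorem isOrientedEmbedding_chartMap (K : Set (ℝ × ℝ)) : IsOrientedEmbedding k K chartMap where
  contDiff := contDiff_chartMap.of_le (by exact_mod_cast le_top)
  injOn := by
    intro x _ y _ h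
    have h0 := congrArg (fun w : Plane => w 0) h
    have h1 := congrArg (fun w : Plane => w 1) h
    exact Prod.ext (by simpa [chartMap] using h0) (by simpa [chartMap] using h1)
  orientation := by
    intro u _
    rw [pd_chartMap, pd_chartMap]
    simp [det2, chartMap, coordVec]

theorem inducedMetric_chartMap (u : ℝ × ℝ) : inducedMetric chartMap u = 1 := by
  ext i j
  simp only [inducedMetric, Matrix.of_apply, pd_chartMap]
  fin_cases i <;> fin_cases j <;> 
    simp [-inner_self_eq_norm_sq_to_K, chartMap, coordVec,
      PiLp.inner_apply, Fin.sum_univ_two]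

/-- The competitor is `chartMap`. Its strain `(1 - g) / 2` vanishes on the center curve, so it is
`O(β)`, the energy density is `O(β²)`, and the area supplies the third power. -/
theorem exists_energy_le (hC : C.IsIsotropic S lam mu) :
    ∃ K : ℝ, ∀ β ∈ Ioc (0 : ℝ) 1, ∀ p : ℝ × ℝ → Plane, IsEnergyMinimizer S C k β p →
      energy S C β p ≤ K * β ^ 3 := by
  have hX : ∀ i j, ThinO S.a S.b S.B 1 fun t => strain S chartMap (t.1, t.2.1) i j := by
    intro i j
    refine ((thinO_metric (S := S) subset_rfl i j).const_mul (-(1 / 2))).congr fun t _ => ?_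
    simp only [strain, inducedMetric_chartMap, Matrix.smul_apply, Matrix.sub_apply, smul_eq_mul]
    ring
  have h0 : ∀ i j, ThinO S.a S.b S.B (1 + 1) fun t =>
      strain S chartMap (t.1, t.2.1) i j - strain S chartMap (t.1, t.2.1) i j := by
    intro i j
    exact thinO_zero.congr fun t _ => sub_self _
  have h1 := (thinO_pair hC subset_rfl h0 hX h0 hX).mono (Nat.le_succ 2)
  have h2 := h1.add (ThinO.isoForm (lam := lam) (mu := mu) hX hX)
  obtain ⟨K, hK⟩ := exists_abs_setIntegral_stripDomain_le S.a_lt_b S.B_continuousOn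
    (h2.const_mul (1 / 2))
  refine ⟨K, fun β hβ p hp => ?_⟩
  refine (hp.minimal chartMap (isOrientedEmbedding_chartMap _)).trans ?_
  refine le_trans (le_of_eq ?_) ((le_abs_self _).trans (hK β hβ))
  unfold energy
  change _ = ∫ u in S.D β, _
  refine integral_congr_ae (Eventually.of_forall fun u => ?_)
  simp only
  ring

end EnergyBound

/-! ### Primitives, cutoff functions and partial derivatives -/

section Calculus

theorem exists_smooth_primitive {F : Type*} [NormedAddCommGroup F] [NormedSpace ℝ F]
    [CompleteSpace F] {f : ℝ → F} (hf : ContDiff ℝ ∞ f) :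
    ∃ h : ℝ → F, ContDiff ℝ ∞ h ∧ ∀ s, HasDerivAt h (f s) s := by
  have hd : ∀ s, HasDerivAt (fun s => ∫ τ in (0 : ℝ)..s, f τ) (f s) s := fun s =>
    hf.continuous.integral_hasStrictDerivAt 0 s |>.hasDerivAt
  refine ⟨fun s => ∫ τ in (0 : ℝ)..s, f τ, ?_, hd⟩
  rw [contDiff_infty_iff_deriv]
  refine ⟨fun s => (hd s).differentiableAt, ?_⟩
  rwa [show deriv (fun s => ∫ τ in (0 : ℝ)..s, f τ) = f from funext fun s => (hd s).deriv]

theorem exists_smooth_bump (c d : ℝ) :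
    ∃ φ : ℝ → ℝ, ContDiff ℝ ∞ φ ∧ (∀ s, 0 ≤ φ s) ∧ (∀ s ∈ Ioo c d, 0 < φ s) ∧
      ∀ s, s ∉ Ioo c d → φ s = 0 := by
  refine ⟨fun s => expNegInvGlue (s - c) * expNegInvGlue (d - s), ?_, ?_, ?_, ?_⟩
  · exact (expNegInvGlue.contDiff.comp (contDiff_id.sub contDiff_const)).mul
      (expNegInvGlue.contDiff.comp (contDiff_const.sub contDiff_id))
  · exact fun s => mul_nonneg (expNegInvGlue.nonneg _) (expNegInvGlue.nonneg _)
  · exact fun s hs => mul_pos (expNegInvGlue.pos_of_pos (sub_pos.2 hs.1))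
      (expNegInvGlue.pos_of_pos (sub_pos.2 hs.2))
  · intro s hs
    by_cases h : c < s
    · have : d ≤ s := not_lt.1 fun h' => hs ⟨h, h'⟩
      simp only [expNegInvGlue.zero_of_nonpos (sub_nonpos.2 this), mul_zero]
    · simp only [expNegInvGlue.zero_of_nonpos (sub_nonpos.2 (not_lt.1 h)), zero_mul]

variable {F : Type*} [NormedAddCommGroup F] [NormedSpace ℝ F]

theorem pd_zero_eq_of_hasDerivAt {f : ℝ × ℝ → F} {u : ℝ × ℝ} (hf : DifferentiableAt ℝ f u) {v : F}
    (h : HasDerivAt (fun s => f (s, u.2)) v u.1) : pd 0 f u = v :=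
  (HasFDerivAt.comp_hasDerivAt (f := fun s : ℝ => (s, u.2)) u.1 hf.hasFDerivAt
    ((hasDerivAt_id u.1).prodMk (hasDerivAt_const u.1 u.2))).unique h

theorem pd_one_eq_of_hasDerivAt {f : ℝ × ℝ → F} {u : ℝ × ℝ} (hf : DifferentiableAt ℝ f u) {v : F}
    (h : HasDerivAt (fun x => f (u.1, x)) v u.2) : pd 1 f u = v :=
  (HasFDerivAt.comp_hasDerivAt (f := fun x : ℝ => (u.1, x)) u.2 hf.hasFDerivAt
    ((hasDerivAt_const u.2 u.1).prodMk (hasDerivAt_id u.2))).unique h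

theorem hasDerivAt_pd_zero {f : ℝ × ℝ → F} {u : ℝ × ℝ} (hf : DifferentiableAt ℝ f u) :
    HasDerivAt (fun s => f (s, u.2)) (pd 0 f u) u.1 :=
  HasFDerivAt.comp_hasDerivAt (f := fun s : ℝ => (s, u.2)) u.1 hf.hasFDerivAt
    ((hasDerivAt_id u.1).prodMk (hasDerivAt_const u.1 u.2))

theorem hasDerivAt_pd_one {f : ℝ × ℝ → F} {u : ℝ × ℝ} (hf : DifferentiableAt ℝ f u) :
    HasDerivAt (fun x => f (u.1, x)) (pd 1 f u) u.2 :=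
  HasFDerivAt.comp_hasDerivAt (f := fun x : ℝ => (u.1, x)) u.2 hf.hasFDerivAt
    ((hasDerivAt_const u.2 u.1).prodMk (hasDerivAt_id u.2))

/-- The direction of the `i`-th chart coordinate among the coordinates `(s, x, β)`. -/
def chartDir (i : Fin 2) : ℝ × ℝ × ℝ := if i = 0 then es else ex

theorem pd_slice {Q : ℝ × ℝ × ℝ → F} (hQ : Differentiable ℝ Q) (β : ℝ) (i : Fin 2) (u : ℝ × ℝ) :
    pd i (fun u : ℝ × ℝ => Q (u.1, u.2, β)) u = dirD (chartDir i) Q (u.1, u.2, β) := by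
  have hd : Differentiable ℝ fun u : ℝ × ℝ => Q (u.1, u.2, β) :=
    hQ.comp (differentiable_fst.prodMk (differentiable_snd.prodMk (differentiable_const β)))
  fin_cases i
  · exact pd_zero_eq_of_hasDerivAt (hd u) (hasDerivAt_slot_s hQ u.1 u.2 β)
  · exact pd_one_eq_of_hasDerivAt (hd u) (hasDerivAt_slot_x hQ u.1 u.2 β)

theorem dirD_inner {A D : ℝ × ℝ × ℝ → Plane} (hA : Differentiable ℝ A) (hD : Differentiable ℝ D)
    (v t : ℝ × ℝ × ℝ) : dirD v (fun t => (inner ℝ (A t) (D t) : ℝ)) t =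
      inner ℝ (A t) (dirD v D t) + inner ℝ (dirD v A t) (D t) :=
  fderiv_inner_apply ℝ (hA t) (hD t) v

theorem dirD_eq_zero_of_eventually {f : ℝ × ℝ × ℝ → F} {t : ℝ × ℝ × ℝ} (v : ℝ × ℝ × ℝ)
    (h : ∀ᶠ t' in 𝓝 t, f t' = 0) : dirD v f t = 0 := by
  have : f =ᶠ[𝓝 t] fun _ => 0 := h
  unfold dirD
  rw [this.fderiv_eq]
  simp

theorem dirD_es_eq_zero {f : ℝ × ℝ × ℝ → F} (hf : Differentiable ℝ f) {x β : ℝ}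
    (h : ∀ s, f (s, x, β) = 0) (s : ℝ) : dirD es f (s, x, β) = 0 := by
  refine (hasDerivAt_slot_s hf s x β).unique ?_
  simp only [h]
  exact hasDerivAt_const s 0

/-- The partial derivatives at `x = β = 0` of a function that is quadratic in `(x, β)` and divisible
by `x`. -/
theorem dirD_quadratic {P R : ℝ × ℝ × ℝ → F} (hP : ContDiff ℝ ∞ P) (hR : ContDiff ℝ ∞ R) :
    ∃ Y : ℝ × ℝ × ℝ → F, (∀ t, Y t = (t.2.1 * t.2.2) • P t + (t.2.1 ^ 2 / 2) • R t) ∧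
      ContDiff ℝ ∞ Y ∧ ∀ s, dirD es Y (s, 0, 0) = 0 ∧ dirD ex Y (s, 0, 0) = 0 ∧
        dirD ex (dirD es Y) (s, 0, 0) = 0 ∧ dirD eb (dirD es Y) (s, 0, 0) = 0 ∧
        dirD ex (dirD ex Y) (s, 0, 0) = R (s, 0, 0) ∧
        dirD eb (dirD ex Y) (s, 0, 0) = P (s, 0, 0) := by
  set Y : ℝ × ℝ × ℝ → F := fun t => (t.2.1 * t.2.2) • P t + (t.2.1 ^ 2 / 2) • R t with hY
  have hPd : Differentiable ℝ P := hP.differentiable (by simp)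
  have hRd : Differentiable ℝ R := hR.differentiable (by simp)
  have px : ContDiff ℝ ∞ (fun t : ℝ × ℝ × ℝ => t.2.1) := contDiff_fst.comp contDiff_snd
  have pb : ContDiff ℝ ∞ (fun t : ℝ × ℝ × ℝ => t.2.2) := contDiff_snd.comp contDiff_snd
  have hYs : ContDiff ℝ ∞ Y := ((px.mul pb).smul hP).add (((px.pow 2).div_const 2).smul hR)
  have hYd : Differentiable ℝ Y := hYs.differentiable (by simp)
  have hYx := contDiff_dirD hYs ex
  have hYb := contDiff_dirD hYs eb
  have hYxd : Differentiable ℝ (dirD ex Y) := hYx.differentiable (by simp)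
  have hYbd : Differentiable ℝ (dirD eb Y) := hYb.differentiable (by simp)
  have hx : ∀ s x β, dirD ex Y (s, x, β) = (x * β) • dirD ex P (s, x, β) + β • P (s, x, β) +
      ((x ^ 2 / 2) • dirD ex R (s, x, β) + x • R (s, x, β)) := by
    intro s x β
    refine (hasDerivAt_slot_x hYd s x β).unique ?_
    have h1 := ((hasDerivAt_id x).mul_const β).smul (hasDerivAt_slot_x hPd s x β)
    have h2 := (((hasDerivAt_id x).pow 2).div_const 2).smul (hasDerivAt_slot_x hRd s x β)
    refine (h1.add h2).congr_deriv ?_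
    simp
  have hb0 : ∀ s, dirD eb Y (s, 0, 0) = 0 := by
    intro s
    refine (hasDerivAt_slot_b hYd s 0 0).unique ?_
    have : (fun y : ℝ => Y (s, 0, y)) = fun _ => 0 := by funext y; simp [hY]
    rw [this]
    exact hasDerivAt_const _ _
  have hx0 : ∀ s, dirD ex Y (s, 0, 0) = 0 := fun s => by rw [hx]; simp
  refine ⟨Y, fun t => rfl, hYs, fun s => ⟨?_, hx0 s, ?_, ?_, ?_, ?_⟩⟩
  · exact dirD_es_eq_zero hYd (fun s => by simp [hY]) s
  · rw [dirD_comm hYs]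
    exact dirD_es_eq_zero hYxd hx0 s
  · rw [dirD_comm hYs]
    exact dirD_es_eq_zero hYbd hb0 s
  · refine (hasDerivAt_slot_x hYxd s 0 0).unique ?_
    simp only [hx]
    have hPx := (contDiff_dirD hP ex).differentiable (by simp)
    have hRx := (contDiff_dirD hR ex).differentiable (by simp)
    have h1 := (((hasDerivAt_id (0 : ℝ)).pow 2).div_const 2).smul (hasDerivAt_slot_x hRx s 0 0)
    have h2 := (hasDerivAt_id (0 : ℝ)).smul (hasDerivAt_slot_x hRd s 0 0)
    have h3 := (h1.add h2)
    simp only [mul_zero, zero_smul, add_zero, zero_add]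
    refine h3.congr_deriv ?_
    simp
  · refine (hasDerivAt_slot_b hYxd s 0 0).unique ?_
    simp only [hx]
    have h2 := (hasDerivAt_id (0 : ℝ)).smul (hasDerivAt_slot_b hPd s 0 0)
    simp only [zero_mul, zero_smul, zero_add, ne_eq, OfNat.ofNat_ne_zero, not_false_eq_true,
      zero_pow, zero_div, add_zero]
    refine h2.congr_deriv ?_
    simp

end Calculus

/-! ### The right-angle rotation of the plane -/

section Rotation

/-- The rotation by a right angle. -/
noncomputable def rot : Plane →L[ℝ] Plane :=
  LinearMap.toContinuousLinearMap
    { toFun := fun v => !₂[-v 1, v 0]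
      map_add' := by intro x y; ext i; fin_cases i <;> simp; ring
      map_smul' := by intro r x; ext i; fin_cases i <;> simp }

theorem rot_apply (v : Plane) : rot v = !₂[-v 1, v 0] := rfl

theorem inner_plane (v w : Plane) : (inner ℝ v w : ℝ) = v 0 * w 0 + v 1 * w 1 := by
  simp only [PiLp.inner_apply, Fin.sum_univ_two]
  simp [mul_comm]

theorem inner_rot (v w : Plane) : (inner ℝ v (rot w) : ℝ) = -det2 v w := by
  rw [inner_plane, rot_apply, det2]
  simp
  ring

theorem inner_rot_antisymm (v w : Plane) :
    (inner ℝ v (rot w) : ℝ) + inner ℝ (rot v) w = 0 := by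
  rw [real_inner_comm w (rot v), inner_rot, inner_rot, det2, det2]
  ring

end Rotation

/-! ### The smooth family of minimizers and its limit at `β = 0` -/

section Family

variable {S : CenteredStrip} {C : StiffnessField} {lam mu c d : ℝ} {k : ℕ∞}
  {p : ℝ → ℝ × ℝ → Plane} {Q : ℝ × ℝ × ℝ → Plane}

/-- The partial derivatives of `Q` along the chart coordinates. -/
noncomputable def frame (Q : ℝ × ℝ × ℝ → Plane) (i : Fin 2) : ℝ × ℝ × ℝ → Plane :=
  dirD (chartDir i) Q

theorem contDiff_frame (hQ : ContDiff ℝ ∞ Q) (i : Fin 2) : ContDiff ℝ ∞ (frame Q i) :=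
  contDiff_dirD hQ _

/-- The maps `p` and `Q` are known to agree only over the part of the strip above `[c, d]`. Their
derivatives therefore agree in its interior, and by continuity also on its boundary. -/
theorem pd_eq_frame (hcd : c < d) (hJ : Icc c d ⊆ Icc S.a S.b) (hQ : ContDiff ℝ ∞ Q)
    (hk : 1 ≤ k) {β : ℝ} (hβ : β ∈ Ioc (0 : ℝ) 1) {p : ℝ × ℝ → Plane} (hp : ContDiff ℝ k p)
    (hpQ : ∀ u ∈ S.D β, u.1 ∈ Icc c d → p u = Q (u.1, u.2, β)) (i : Fin 2) :
    ∀ u ∈ stripDomain c d S.B β, pd i p u = frame Q i (u.1, u.2, β) := by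
  have hB := S.continuousOn_B hJ
  have hpos : ∀ s ∈ Icc c d, 0 < S.B s := fun s hs => S.B_pos s (hJ hs)
  have hQd : Differentiable ℝ Q := hQ.differentiable (by simp)
  have hclosed : IsClosed {u : ℝ × ℝ | pd i p u = frame Q i (u.1, u.2, β)} := by
    refine isClosed_eq (continuous_pd hk hp i) ((contDiff_frame hQ i).continuous.comp ?_)
    fun_prop
  have hopen : {u : ℝ × ℝ | u.1 ∈ Ioo c d ∧ |u.2| < β * S.B u.1} ⊆
      {u : ℝ × ℝ | pd i p u = frame Q i (u.1, u.2, β)} := by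
    intro u hu
    have hev : p =ᶠ[𝓝 u] fun u => Q (u.1, u.2, β) := by
      filter_upwards [(isOpen_stripInterior hB).mem_nhds hu] with v hv
      exact hpQ v (stripDomain_subset_D hJ (mem_stripDomain.2
        ⟨Ioo_subset_Icc_self hv.1, hv.2.le⟩)) (Ioo_subset_Icc_self hv.1)
    change pd i p u = dirD (chartDir i) Q (u.1, u.2, β)
    rw [← pd_slice hQd]
    unfold pd
    rw [hev.fderiv_eq]
  exact (stripDomain_subset_closure hcd hB hpos hβ.1).trans (closure_minimal hopen hclosed)

/-- The strain of the family as a smooth symmetric tensor field of `(s, x, β)`. -/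
noncomputable def familyStrain (S : CenteredStrip) (Q : ℝ × ℝ × ℝ → Plane) (t : ℝ × ℝ × ℝ) :
    Matrix (Fin 2) (Fin 2) ℝ :=
  -- The metric is known to be symmetric only on `D`; symmetrizing its coefficients makes the field
  -- symmetric everywhere.
  Matrix.of fun i j => (inner ℝ (frame Q i t) (frame Q j t) -
    (S.g (t.1, t.2.1) i j + S.g (t.1, t.2.1) j i) / 2) / 2

theorem contDiff_familyStrain (hQ : ContDiff ℝ ∞ Q) (i j : Fin 2) :
    ContDiff ℝ ∞ fun t => familyStrain S Q t i j :=
  (((contDiff_frame hQ i).inner ℝ (contDiff_frame hQ j)).sub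
    (((contDiff_chart (S.g_smooth i j)).add (contDiff_chart (S.g_smooth j i))).div_const 2)).div_const
    2

theorem continuous_familyStrain (hQ : ContDiff ℝ ∞ Q) : Continuous (familyStrain S Q) :=
  continuous_matrix fun i j => (contDiff_familyStrain hQ i j).continuous

theorem familyStrain_symm (t : ℝ × ℝ × ℝ) (i j : Fin 2) :
    familyStrain S Q t j i = familyStrain S Q t i j := by
  simp only [familyStrain, Matrix.of_apply, real_inner_comm (frame Q i t)]
  ring

theorem CenteredStrip.g_symm (S : CenteredStrip) {u : ℝ × ℝ} (hu : u ∈ S.D 1) (i j : Fin 2) :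
    S.g u j i = S.g u i j := by
  have := (S.g_posDef u hu).isHermitian.apply i j
  simpa using this

/-- The family `p β` of minimizers that is given by the smooth map `Q` over `[c, d]`. -/
structure IsMinimizingFamily (S : CenteredStrip) (C : StiffnessField) (k : ℕ∞) (c d : ℝ)
    (p : ℝ → ℝ × ℝ → Plane) (Q : ℝ × ℝ × ℝ → Plane) : Prop where
  lt : c < d
  subset : Icc c d ⊆ Icc S.a S.b
  one_le : 1 ≤ k
  smooth : ContDiff ℝ ∞ Q
  minimizer : ∀ β ∈ Ioc (0 : ℝ) 1, IsEnergyMinimizer S C k β (p β)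
  eq : ∀ β ∈ Ioc (0 : ℝ) 1, ∀ u ∈ S.D β, u.1 ∈ Icc c d → p β u = Q (u.1, u.2, β)

namespace IsMinimizingFamily

variable (h : IsMinimizingFamily S C k c d p Q)
include h

theorem pd_eq {β : ℝ} (hβ : β ∈ Ioc (0 : ℝ) 1) (i : Fin 2) {u : ℝ × ℝ}
    (hu : u ∈ stripDomain c d S.B β) : pd i (p β) u = frame Q i (u.1, u.2, β) :=
  pd_eq_frame h.lt h.subset h.smooth h.one_le hβ (h.minimizer β hβ).embedding.contDiff
    (h.eq β hβ) i u hu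

theorem B_pos : ∀ s ∈ Icc c d, 0 < S.B s := fun s hs => S.B_pos s (h.subset hs)

theorem B_cont : ContinuousOn S.B (Icc c d) := S.continuousOn_B h.subset

theorem strain_eq {β : ℝ} (hβ : β ∈ Ioc (0 : ℝ) 1) {u : ℝ × ℝ}
    (hu : u ∈ stripDomain c d S.B β) : strain S (p β) u = familyStrain S Q (u.1, u.2, β) := by
  ext i j
  have hD := S.D_subset hβ.2 (stripDomain_subset_D h.subset hu)
  simp only [strain, inducedMetric, familyStrain, Matrix.smul_apply, Matrix.sub_apply,
    Matrix.of_apply, h.pd_eq hβ _ hu, smul_eq_mul, S.g_symm hD i j]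
  ring

/-- To leading order the energy over `[c, d]` is `β` times the integral of `B` times the stiffness
form of the limit strain, while the minimizers have energy `O(β³)`. Positivity then forces the limit
strain to vanish. -/
theorem familyStrain_center (hC : C.IsIsotropic S lam mu) (hCpos : C.IsPositive S) :
    ∀ s ∈ Icc c d, familyStrain S Q (s, 0, 0) = 0 := by
  obtain ⟨K, hK⟩ := exists_energy_le (k := k) hC
  have hEs := contDiff_familyStrain (S := S) h.smooth
  have hEc := continuous_familyStrain (S := S) h.smooth
  have hX : ∀ i j, ThinO c d S.B (0 + 1) fun t =>
      familyStrain S Q t i j - familyStrain S Q (t.1, 0, 0) i j :=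
    fun i j => taylor_one h.B_cont (hEs i j)
  have hL : ∀ i j, ThinO c d S.B 0 fun t => familyStrain S Q (t.1, 0, 0) i j := fun i j =>
    smooth_thinO_zero h.B_cont ((contDiff_atCenter (hEs i j)).comp contDiff_fst)
  have hG := (thinO_beta (c := c) (d := d) (B := S.B)).mul
    (thinO_beta.mul (thinO_beta.mul (thinO_pair hC h.subset hX hL hX hL)))
  have hcont : Continuous fun s => isoForm lam mu (familyStrain S Q (s, 0, 0))
      (familyStrain S Q (s, 0, 0)) := by
    have : ∀ i j, Continuous fun s => familyStrain S Q (s, 0, 0) i j := fun i j =>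
      (contDiff_atCenter (hEs i j)).continuous
    unfold isoForm
    fun_prop
  have hsymm : ∀ s, (familyStrain S Q (s, 0, 0)).IsSymm := fun s => by
    ext i j; exact familyStrain_symm _ _ _
  -- The density has leading order zero; the factor `β³` in `G` lifts it to the cubic normalization,
  -- with `p₀` as its only coefficient.
  have key := even_coeff_eq_zero (K := |2 * K|) h.lt h.B_cont h.B_pos hcont
    (continuous_const (y := (0 : ℝ))) (continuous_const (y := (0 : ℝ)))
    (continuous_const (y := (0 : ℝ))) (fun s _ => hCpos.isoForm_nonneg hC (hsymm s))
    (fun s _ => le_rfl)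
    (G := fun t => t.2.2 ^ 3 * (C.pair (t.1, t.2.1) (familyStrain S Q t) (familyStrain S Q t) *
      Real.sqrt (S.g (t.1, t.2.1)).det)) ?_ (hG.congr fun t _ => by ring) ?_
  · intro s hs
    exact hCpos.eq_zero hC (hsymm s) (key s hs).1
  · intro β hβ
    have hE' : Continuous fun u : ℝ × ℝ => familyStrain S Q (u.1, u.2, β) :=
      hEc.comp (by fun_prop)
    have hint := ((hC.continuousOn_pair hβ.2 hE' hE').mono
      (stripDomain_subset_D h.subset)).integrableOn_compact (μ := volume)
        (isCompact_stripDomain h.B_cont h.B_pos hβ.1)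
    exact Integrable.const_mul hint (β ^ 3)
  · intro β hβ
    have hpβ := h.minimizer β hβ
    have hEp := continuous_strain (S := S) h.one_le hpβ.embedding.contDiff
    have hm := (isCompact_stripDomain h.B_cont h.B_pos hβ.1).measurableSet
    -- The energy bound concerns the whole strip; it passes to the part over `[c, d]` because the
    -- density is nonnegative.
    have h1 : ∫ u in stripDomain c d S.B β, C.pair u (strain S (p β) u) (strain S (p β) u) *
        Real.sqrt (S.g u).det ≤ ∫ u in S.D β, C.pair u (strain S (p β) u) (strain S (p β) u) *
        Real.sqrt (S.g u).det := by
      refine setIntegral_mono_set ((hC.continuousOn_pair hβ.2 hEp hEp).integrableOn_compact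
        (S.isCompact_D hβ.1)) ?_ (stripDomain_subset_D h.subset).eventuallyLE
      filter_upwards [ae_restrict_mem (S.isCompact_D hβ.1).measurableSet] with u hu
      have hu1 := S.D_subset hβ.2 hu
      refine mul_nonneg ?_ (Real.sqrt_nonneg _)
      by_cases h0 : strain S (p β) u = 0
      · rw [h0]
        simp [StiffnessField.pair]
      · refine (hCpos u hu1 _ ?_ h0).le
        ext i j
        simp only [Matrix.transpose_apply, strain, inducedMetric, Matrix.smul_apply,
          Matrix.sub_apply, Matrix.of_apply, S.g_symm hu1 i j, real_inner_comm (pd i (p β) u)]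
    have h2 : ∫ u in S.D β, C.pair u (strain S (p β) u) (strain S (p β) u) *
        Real.sqrt (S.g u).det = 2 * energy S C β (p β) := by
      unfold energy
      rw [← integral_const_mul]
      refine integral_congr_ae (Eventually.of_forall fun u => ?_)
      simp only
      ring
    have h3 : ∫ u in stripDomain c d S.B β, β ^ 3 * (C.pair (u.1, u.2)
        (familyStrain S Q (u.1, u.2, β)) (familyStrain S Q (u.1, u.2, β)) *
        Real.sqrt (S.g (u.1, u.2)).det) = β ^ 3 * ∫ u in stripDomain c d S.B β,
        C.pair u (strain S (p β) u) (strain S (p β) u) * Real.sqrt (S.g u).det := by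
      rw [← integral_const_mul]
      refine setIntegral_congr_fun hm fun u hu => ?_
      simp only [h.strain_eq hβ hu]
    have h4 := hK β hβ (p β) hpβ
    have hβ3 : 0 < β ^ 3 := pow_pos hβ.1 3
    refine h3.le.trans ?_
    calc β ^ 3 * ∫ u in stripDomain c d S.B β,
          C.pair u (strain S (p β) u) (strain S (p β) u) * Real.sqrt (S.g u).det
        ≤ β ^ 3 * (2 * (K * β ^ 3)) := by
          refine mul_le_mul_of_nonneg_left ?_ hβ3.le
          linarith
      _ = 2 * K * β * β ^ 5 := by ring
      _ ≤ |2 * K| * β ^ 5 := by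
          refine mul_le_mul_of_nonneg_right ?_ (pow_nonneg hβ.1.le 5)
          refine (le_abs_self _).trans ?_
          rw [abs_mul, abs_of_pos hβ.1]
          exact mul_le_of_le_one_right (abs_nonneg _) hβ.2

theorem inner_frame_center (hC : C.IsIsotropic S lam mu) (hCpos : C.IsPositive S) {s : ℝ}
    (hs : s ∈ Icc c d) (i j : Fin 2) :
    (inner ℝ (frame Q i (s, 0, 0)) (frame Q j (s, 0, 0)) : ℝ) =
      (1 : Matrix (Fin 2) (Fin 2) ℝ) i j := by
  have h0 := congrArg (fun M : Matrix (Fin 2) (Fin 2) ℝ => M i j)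
    (h.familyStrain_center hC hCpos s hs)
  simp only [familyStrain, Matrix.of_apply, Matrix.zero_apply,
    S.g_center s (h.subset hs)] at h0
  have : (1 : Matrix (Fin 2) (Fin 2) ℝ) j i = (1 : Matrix (Fin 2) (Fin 2) ℝ) i j := by
    rw [Matrix.one_apply, Matrix.one_apply]; simp only [eq_comm]
  rw [this] at h0
  linarith

/-- Orthonormality of the limit frame leaves the values `±1`. The orientation of the embeddings,
passed to the limit `β → 0⁺`, excludes `-1`. -/
theorem det2_frame_center (hC : C.IsIsotropic S lam mu) (hCpos : C.IsPositive S) {s : ℝ}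
    (hs : s ∈ Icc c d) : det2 (frame Q 0 (s, 0, 0)) (frame Q 1 (s, 0, 0)) = 1 := by
  have hnn : 0 ≤ det2 (frame Q 0 (s, 0, 0)) (frame Q 1 (s, 0, 0)) := by
    have hc : Continuous fun β : ℝ => det2 (frame Q 0 (s, 0, β)) (frame Q 1 (s, 0, β)) :=
      continuous_det2 ((contDiff_frame h.smooth 0).continuous.comp (by fun_prop))
        ((contDiff_frame h.smooth 1).continuous.comp (by fun_prop))
    refine ge_of_tendsto ((hc.tendsto 0).mono_left (nhdsWithin_le_nhds (s := Ioi 0))) ?_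
    filter_upwards [Ioc_mem_nhdsGT one_pos] with β hβ
    have hmem := center_mem_stripDomain h.B_pos hβ.1.le hs
    have := (h.minimizer β hβ).embedding.orientation _ (stripDomain_subset_D h.subset hmem)
    rw [h.pd_eq hβ _ hmem, h.pd_eq hβ _ hmem] at this
    exact this.le
  have h00 := h.inner_frame_center hC hCpos hs 0 0
  have h01 := h.inner_frame_center hC hCpos hs 0 1
  have h11 := h.inner_frame_center hC hCpos hs 1 1
  rw [inner_plane] at h00 h01 h11
  simp only [Matrix.one_apply_eq, ne_eq, zero_ne_one, not_false_eq_true, Matrix.one_apply_ne]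
    at h00 h01 h11
  unfold det2 at hnn ⊢
  set a := frame Q 0 (s, 0, 0)
  set b := frame Q 1 (s, 0, 0)
  have hsq : (a 0 * b 1 - a 1 * b 0) ^ 2 = 1 := by
    have : (a 0 * b 1 - a 1 * b 0) ^ 2 = (a 0 * a 0 + a 1 * a 1) * (b 0 * b 0 + b 1 * b 1) -
      (a 0 * b 0 + a 1 * b 1) ^ 2 := by ring
    rw [this, h00, h01, h11]; norm_num
  nlinarith

end IsMinimizingFamily

end Family

/-! ### Variations with prescribed leading strain -/

section TestField

variable {S : CenteredStrip} {C : StiffnessField} {lam mu c d : ℝ} {k : ℕ∞}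
  {p : ℝ → ℝ × ℝ → Plane} {Q : ℝ × ℝ × ℝ → Plane}

/-- An infinitesimal rotation with variable angle does not contribute to the variation of the
strain, up to the derivatives of the angle. -/
theorem strainVar_of_pd {p η : ℝ × ℝ → Plane} {u : ℝ × ℝ} (r : ℝ) (ζ : Fin 2 → Plane)
    (hη : ∀ i, pd i η u = r • rot (pd i p u) + ζ i) (i j : Fin 2) :
    strainVar p η u i j = (inner ℝ (pd i p u) (ζ j) + inner ℝ (ζ i) (pd j p u)) / 2 := by
  have := inner_rot_antisymm (pd i p u) (pd j p u)
  simp only [strainVar, Matrix.of_apply, hη, inner_add_left, inner_add_right, inner_smul_left,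
    inner_smul_right, conj_trivial]
  linear_combination r / 2 * this

/-- The split isolates `θ • rot (∂p)`, which `strainVar_of_pd` discards. Hence only the derivative
`ψ` of the angle affects the strain, and `θ` need not be small or compactly supported. -/
theorem pd_testField {p : ℝ × ℝ → Plane} (hp : Differentiable ℝ p) {θ ψ : ℝ → ℝ}
    (hθ : ∀ s, HasDerivAt θ (ψ s) s) {w ϖ : ℝ → Plane} (hw : ∀ s, HasDerivAt w (ϖ s) s)
    {Y : ℝ × ℝ × ℝ → Plane} (hY : Differentiable ℝ Y) (β : ℝ) (u : ℝ × ℝ) (i : Fin 2) :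
    pd i (fun u => θ u.1 • rot (p u) + w u.1 + Y (u.1, u.2, β)) u =
      θ u.1 • rot (pd i p u) + ((if i = 0 then ψ u.1 • rot (p u) + ϖ u.1 else 0) +
        dirD (chartDir i) Y (u.1, u.2, β)) := by
  have hd : DifferentiableAt ℝ (fun u => θ u.1 • rot (p u) + w u.1 + Y (u.1, u.2, β)) u := by
    have h1 : Differentiable ℝ θ := fun s => (hθ s).differentiableAt
    have h2 : Differentiable ℝ w := fun s => (hw s).differentiableAt
    have h3 : Differentiable ℝ fun u : ℝ × ℝ => Y (u.1, u.2, β) :=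
      hY.comp (differentiable_fst.prodMk (differentiable_snd.prodMk (differentiable_const β)))
    have h4 : Differentiable ℝ fun u : ℝ × ℝ => θ u.1 • rot (p u) :=
      (h1.comp differentiable_fst).smul (rot.differentiable.comp hp)
    exact ((h4.add (h2.comp differentiable_fst)).add h3) u
  fin_cases i
  · refine pd_zero_eq_of_hasDerivAt hd ?_
    have h1 := (hθ u.1).smul (rot.hasFDerivAt.comp_hasDerivAt u.1 (hasDerivAt_pd_zero (hp u)))
    refine ((h1.add (hw u.1)).add (hasDerivAt_slot_s hY u.1 u.2 β)).congr_deriv ?_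
    simp [chartDir]
    abel
  · refine pd_one_eq_of_hasDerivAt hd ?_
    have h1 := (rot.hasFDerivAt.comp_hasDerivAt u.2 (hasDerivAt_pd_one (hp u))).const_smul (θ u.1)
    refine ((h1.add (hasDerivAt_const u.2 (w u.1))).add
      (hasDerivAt_slot_x hY u.1 u.2 β)).congr_deriv ?_
    simp [chartDir]

namespace IsMinimizingFamily

/-- The Euler–Lagrange equation, tested with a variation whose strain over `[c, d]` is, to leading
order, a prescribed linear function of `(x, β)`, and which is rigid outside of `[c, d]`. -/
theorem exists_test (h : IsMinimizingFamily S C k c d p Q) (hC : C.IsIsotropic S lam mu)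
    (hCpos : C.IsPositive S) {φ : ℝ → ℝ} (hφ : ContDiff ℝ ∞ φ) (hφ0 : ∀ s, s ∉ Ioo c d → φ s = 0)
    {a b : ℝ → Matrix (Fin 2) (Fin 2) ℝ} (ha : ∀ i j, ContDiff ℝ ∞ fun s => a s i j)
    (hb : ∀ i j, ContDiff ℝ ∞ fun s => b s i j) (ha' : ∀ s, a s 1 0 = a s 0 1)
    (hb' : ∀ s, b s 1 0 = b s 0 1) :
    ∃ V : ℝ × ℝ × ℝ → Matrix (Fin 2) (Fin 2) ℝ, Continuous V ∧
      (∀ i j, ThinO c d S.B 2 fun t =>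
        V t i j - φ t.1 * (t.2.1 * a t.1 i j + t.2.2 * b t.1 i j)) ∧
      ∀ β ∈ Ioc (0 : ℝ) 1, ∫ u in stripDomain c d S.B β,
        (C.pair u (familyStrain S Q (u.1, u.2, β)) (V (u.1, u.2, β)) +
          C.pair u (V (u.1, u.2, β)) (familyStrain S Q (u.1, u.2, β))) *
          Real.sqrt (S.g u).det = 0 := by
  have hQd : Differentiable ℝ Q := h.smooth.differentiable (by simp)
  have hf := contDiff_frame h.smooth
  -- Bending: rotating the cross sections at the rate `ψ` produces the longitudinal strain `-ψ x`,
  -- which must be `φ a₀₀ x`.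
  set ψ : ℝ → ℝ := fun s => -(φ s * a s 0 0) with hψ
  have hψs : ContDiff ℝ ∞ ψ := (hφ.mul (ha 0 0)).neg
  obtain ⟨θ, hθs, hθ⟩ := exists_smooth_primitive hψs
  -- Stretch and shear of the center curve, supplying `b₀₀` and `b₀₁`. The factor 2 compensates for
  -- the half in the symmetrized strain.
  set H : ℝ × ℝ × ℝ → Plane := fun t => φ t.1 • (b t.1 0 0 • frame Q 0 (t.1, 0, t.2.2) +
    (2 * b t.1 0 1) • frame Q 1 (t.1, 0, t.2.2)) with hH
  -- The velocity of the translation `w`. Its first term cancels the displacement that the varying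
  -- rotation causes on the center curve itself.
  set ϖ : ℝ × ℝ × ℝ → Plane := fun t =>
    ψ t.1 • (-rot (Q (t.1, 0, t.2.2))) + t.2.2 • H t with hϖ
  have hproj : ContDiff ℝ ∞ fun t : ℝ × ℝ × ℝ => ((t.1, 0, t.2.2) : ℝ × ℝ × ℝ) :=
    contDiff_fst.prodMk (contDiff_const.prodMk (contDiff_snd.comp contDiff_snd))
  have hHs : ContDiff ℝ ∞ H := (hφ.comp contDiff_fst).smul
    ((((hb 0 0).comp contDiff_fst).smul ((hf 0).comp hproj)).add
      (((hb 0 1).comp contDiff_fst |>.const_smul (2 : ℝ)).smul ((hf 1).comp hproj)))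
  have hϖs : ContDiff ℝ ∞ ϖ := ((hψs.comp contDiff_fst).smul
    (rot.contDiff.comp (h.smooth.comp hproj)).neg).add ((contDiff_snd.comp contDiff_snd).smul hHs)
  have hϖ1 : ∀ β, ContDiff ℝ ∞ fun s => ϖ (s, 0, β) := fun β =>
    hϖs.comp (contDiff_id.prodMk contDiff_const)
  -- The correction `Y` supplies the remaining components `a₁₁`, `a₀₁` and `b₁₁` through its
  -- `x`-derivative. Being quadratic in `(x, β)`, it does not disturb the longitudinal strain to
  -- first order.
  obtain ⟨Y, hYeq, hYs, hY0⟩ := dirD_quadratic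
    (P := fun t => (φ t.1 * b t.1 1 1) • frame Q 1 t)
    (R := fun t => φ t.1 • (a t.1 1 1 • frame Q 1 t + (2 * a t.1 0 1) • frame Q 0 t))
    (((hφ.mul (hb 1 1)).comp contDiff_fst).smul (hf 1))
    ((hφ.comp contDiff_fst).smul ((((ha 1 1).comp contDiff_fst).smul (hf 1)).add
      (((ha 0 1).comp contDiff_fst |>.const_smul (2 : ℝ)).smul (hf 0))))
  have hYd : Differentiable ℝ Y := hYs.differentiable (by simp)
  have hYdir := fun v => contDiff_dirD hYs v
  set ξ : Fin 2 → ℝ × ℝ × ℝ → Plane := fun i t =>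
    (if i = 0 then ψ t.1 • rot (Q t) + ϖ t else 0) + dirD (chartDir i) Y t with hξ
  have hξs : ∀ i, ContDiff ℝ ∞ (ξ i) := by
    intro i
    refine ContDiff.add ?_ (hYdir _)
    split_ifs
    · exact ((hψs.comp contDiff_fst).smul (rot.contDiff.comp h.smooth)).add hϖs
    · exact contDiff_const
  have hξd : ∀ i, Differentiable ℝ (ξ i) := fun i => (hξs i).differentiable (by simp)
  have hYdd : ∀ v, Differentiable ℝ (dirD v Y) := fun v => (hYdir v).differentiable (by simp)
  -- the values of `ξ` and its derivatives at the center curve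
  have hξ0 : ∀ i s, ξ i (s, 0, 0) = 0 := by
    intro i s
    fin_cases i
    · simp [hξ, hϖ, chartDir, (hY0 s).1]
    · simp [hξ, chartDir, (hY0 s).2.1]
  have hξ0x : ∀ s, dirD ex (ξ 0) (s, 0, 0) = ψ s • rot (frame Q 1 (s, 0, 0)) := by
    intro s
    refine (hasDerivAt_slot_x (hξd 0) s 0 0).unique ?_
    have h1 := (rot.hasFDerivAt.comp_hasDerivAt (0 : ℝ)
      (hasDerivAt_slot_x hQd s 0 0)).const_smul (ψ s)
    have h2 := hasDerivAt_slot_x (hYdd es) s 0 0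
    rw [(hY0 s).2.2.1] at h2
    have h3 := ((h1.add (hasDerivAt_const 0 (ϖ (s, 0, 0)))).add h2)
    simp only [add_zero] at h3
    exact h3
  have hξ0b : ∀ s, dirD eb (ξ 0) (s, 0, 0) = H (s, 0, 0) := by
    intro s
    refine (hasDerivAt_slot_b (hξd 0) s 0 0).unique ?_
    have h1 := (hasDerivAt_id (0 : ℝ)).smul
      (hasDerivAt_slot_b (hHs.differentiable (by simp)) s 0 0)
    have h2 := hasDerivAt_slot_b (hYdd es) s 0 0
    rw [(hY0 s).2.2.2.1] at h2
    have h3 := h1.add h2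
    have e : (fun y => ξ 0 (s, 0, y)) = (fun y => id y • H (s, 0, y)) +
        fun y => dirD es Y (s, 0, y) := by
      funext y
      simp [hξ, hϖ, chartDir]
    rw [e]
    refine h3.congr_deriv ?_
    simp
  have hξ1 : ξ 1 = dirD ex Y := by
    funext t
    simp [hξ, chartDir]
  set V : ℝ × ℝ × ℝ → Matrix (Fin 2) (Fin 2) ℝ := fun t => Matrix.of fun i j =>
    (inner ℝ (frame Q i t) (ξ j t) + inner ℝ (ξ i t) (frame Q j t)) / 2 with hV
  have hVs : ∀ i j, ContDiff ℝ ∞ fun t => V t i j := fun i j =>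
    (((hf i).inner ℝ (hξs j)).add ((hξs i).inner ℝ (hf j))).div_const 2
  have hfd : ∀ i, Differentiable ℝ (frame Q i) := fun i => (hf i).differentiable (by simp)
  have hVder : ∀ v i j s, dirD v (fun t => V t i j) (s, 0, 0) =
      (inner ℝ (frame Q i (s, 0, 0)) (dirD v (ξ j) (s, 0, 0)) +
        inner ℝ (dirD v (ξ i) (s, 0, 0)) (frame Q j (s, 0, 0))) / 2 := by
    intro v i j s
    have e : dirD v (fun t => V t i j) (s, 0, 0) =
        (dirD v (fun t => (inner ℝ (frame Q i t) (ξ j t) : ℝ)) (s, 0, 0) +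
          dirD v (fun t => (inner ℝ (ξ i t) (frame Q j t) : ℝ)) (s, 0, 0)) / 2 := by
      have d1 := (((hf i).inner ℝ (hξs j)).differentiable (by simp) (s, 0, 0)).hasFDerivAt
      have d2 := (((hξs i).inner ℝ (hf j)).differentiable (by simp) (s, 0, 0)).hasFDerivAt
      have d3 := (d1.add d2).const_mul (1 / 2 : ℝ)
      have e0 : (fun t => V t i j) = fun t => 1 / 2 * ((fun t => (inner ℝ (frame Q i t) (ξ j t) : ℝ)) +
          fun t => (inner ℝ (ξ i t) (frame Q j t) : ℝ)) t := by
        funext t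
        simp only [hV, Matrix.of_apply, Pi.add_apply]
        ring
      unfold dirD
      rw [e0, d3.fderiv]
      simp only [smul_apply, add_apply, smul_eq_mul]
      ring
    rw [e, dirD_inner (hfd i) (hξd j), dirD_inner (hξd i) (hfd j), hξ0, hξ0]
    simp
  have hVx : ∀ s ∈ Icc c d, ∀ i j, dirD ex (fun t => V t i j) (s, 0, 0) = φ s * a s i j := by
    intro s hs i j
    have h00 := h.inner_frame_center hC hCpos hs 0 0
    have h01 := h.inner_frame_center hC hCpos hs 0 1
    have h11 := h.inner_frame_center hC hCpos hs 1 1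
    have hdet := h.det2_frame_center hC hCpos hs
    simp only [Matrix.one_apply_eq, ne_eq, zero_ne_one, not_false_eq_true, Matrix.one_apply_ne]
      at h00 h01 h11
    have h10 := (real_inner_comm (frame Q 0 (s, 0, 0)) (frame Q 1 (s, 0, 0))).trans h01
    -- The orientation of the limit frame enters here: it fixes the sign of the bending strain.
    have hr0 : (inner ℝ (frame Q 0 (s, 0, 0)) (rot (frame Q 1 (s, 0, 0))) : ℝ) = -1 := by
      rw [inner_rot, hdet]
    have hr1 : (inner ℝ (frame Q 1 (s, 0, 0)) (rot (frame Q 1 (s, 0, 0))) : ℝ) = 0 := by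
      rw [inner_rot, det2]; ring
    have hr0' := (real_inner_comm _ _).trans hr0
    have hr1' := (real_inner_comm _ _).trans hr1
    rw [hVder]
    have e1 : dirD ex (ξ 1) (s, 0, 0) =
        φ s • (a s 1 1 • frame Q 1 (s, 0, 0) + (2 * a s 0 1) • frame Q 0 (s, 0, 0)) := by
      rw [hξ1]; exact (hY0 s).2.2.2.2.1
    fin_cases i <;> fin_cases j <;>
      simp only [Fin.zero_eta, Fin.mk_one, hξ0x, e1, inner_smul_left, inner_smul_right,
        inner_add_left, inner_add_right, conj_trivial, h00, h01, h10, h11, hr0, hr1, hr0', hr1',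
        ha', hψ] <;> ring
  have hVb : ∀ s ∈ Icc c d, ∀ i j, dirD eb (fun t => V t i j) (s, 0, 0) = φ s * b s i j := by
    intro s hs i j
    have h00 := h.inner_frame_center hC hCpos hs 0 0
    have h01 := h.inner_frame_center hC hCpos hs 0 1
    have h11 := h.inner_frame_center hC hCpos hs 1 1
    simp only [Matrix.one_apply_eq, ne_eq, zero_ne_one, not_false_eq_true, Matrix.one_apply_ne]
      at h00 h01 h11
    have h10 := (real_inner_comm (frame Q 0 (s, 0, 0)) (frame Q 1 (s, 0, 0))).trans h01
    rw [hVder]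
    have e1 : dirD eb (ξ 1) (s, 0, 0) = (φ s * b s 1 1) • frame Q 1 (s, 0, 0) := by
      rw [hξ1]; exact (hY0 s).2.2.2.2.2
    fin_cases i <;> fin_cases j <;>
      simp only [Fin.zero_eta, Fin.mk_one, hξ0b, e1, inner_smul_left, inner_smul_right,
        inner_add_left, inner_add_right, conj_trivial, h00, h01, h10, h11, hb', hH] <;> ring
  refine ⟨V, continuous_matrix fun i j => (hVs i j).continuous, fun i j => ?_, fun β hβ => ?_⟩
  · refine (taylor_two h.B_cont (hVs i j)).congr fun t ht => ?_
    have hs : t.1 ∈ Icc c d := ht.2.1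
    have : V (t.1, 0, 0) i j = 0 := by
      simp only [hV, Matrix.of_apply, hξ0, inner_zero_left, inner_zero_right]
      norm_num
    rw [hVx _ hs, hVb _ hs, this]
    ring
  · have hpβ := h.minimizer β hβ
    have hpc := hpβ.embedding.contDiff
    have hpd := differentiable_of_contDiff h.one_le hpc
    -- `w` is needed only for each `β` separately; the uniform estimates involve its derivative `ϖ`
    -- alone.
    obtain ⟨w, hws, hw⟩ := exists_smooth_primitive (hϖ1 β)
    have hkle : (k : WithTop ℕ∞) ≤ ∞ := by exact_mod_cast le_top
    have hηs : ContDiff ℝ k fun u => θ u.1 • rot (p β u) + w u.1 + Y (u.1, u.2, β) := by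
      have h1 : ContDiff ℝ k fun u : ℝ × ℝ => θ u.1 := (hθs.comp contDiff_fst).of_le hkle
      have h2 : ContDiff ℝ k fun u : ℝ × ℝ => w u.1 := (hws.comp contDiff_fst).of_le hkle
      have h3 : ContDiff ℝ k fun u : ℝ × ℝ => Y (u.1, u.2, β) := (hYs.comp
        (contDiff_fst.prodMk (contDiff_snd.prodMk contDiff_const))).of_le hkle
      exact ((h1.smul (rot.contDiff.comp hpc)).add h2).add h3
    have hEL := hpβ.firstVariation hC h.one_le hβ hηs
    have hvar := fun u => strainVar_of_pd (p := p β) (u := u) (θ u.1) _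
      (pd_testField hpd hθ hw hYd β u)
    have hm := (isCompact_stripDomain h.B_cont h.B_pos hβ.1).measurableSet
    refine (setIntegral_congr_fun hm ?_).trans
      ((setIntegral_eq_of_subset_of_forall_sdiff_eq_zero (S.isCompact_D hβ.1).measurableSet
        (stripDomain_subset_D h.subset) ?_).symm.trans hEL)
    · intro u hu
      have hVu : strainVar (p β) (fun u => θ u.1 • rot (p β u) + w u.1 + Y (u.1, u.2, β)) u =
          V (u.1, u.2, β) := by
        ext i j
        rw [hvar u i j]
        simp only [h.pd_eq hβ _ hu, h.eq β hβ u (stripDomain_subset_D h.subset hu) hu.1]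
        rfl
      simp only [hVu, h.strain_eq hβ hu]
    -- Outside `[c, d]` the function `φ` vanishes, so `θ` and `w` are locally constant and `Y = 0`.
    -- The variation is an infinitesimal rigid motion there, in general nonzero, and its strain
    -- vanishes.
    · intro u hu
      have hu1 : u.1 ∉ Icc c d := fun h' => hu.2 ⟨h', hu.1.2⟩
      have hφu : φ u.1 = 0 := hφ0 _ fun h' => hu1 (Ioo_subset_Icc_self h')
      have hYu : ∀ i, dirD (chartDir i) Y (u.1, u.2, β) = 0 := by
        intro i
        refine dirD_eq_zero_of_eventually _ ?_
        have hev : ∀ᶠ t : ℝ × ℝ × ℝ in 𝓝 (u.1, u.2, β), t.1 ∉ Icc c d :=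
          
          (continuous_fst.tendsto (u.1, u.2, β)).eventually
            (isClosed_Icc.isOpen_compl.mem_nhds hu1)
        filter_upwards [hev] with t ht
        have : φ t.1 = 0 := hφ0 _ fun h' => ht (Ioo_subset_Icc_self h')
        rw [hYeq]
        simp [this]
      have hVu : strainVar (p β) (fun u => θ u.1 • rot (p β u) + w u.1 + Y (u.1, u.2, β)) u = 0 := by
        ext i j
        rw [hvar u i j]
        simp [hYu, hϖ, hψ, hH, hφu]
      rw [hVu]
      simp [StiffnessField.pair]

end IsMinimizingFamily

end TestField

/-! ### Vanishing of the derivatives of the strain at the center curve -/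

section Stages

variable {S : CenteredStrip} {C : StiffnessField} {lam mu c d : ℝ} {k : ℕ∞}
  {p : ℝ → ℝ × ℝ → Plane} {Q : ℝ × ℝ × ℝ → Plane}

theorem eq_zero_on_Icc {F : Type*} [TopologicalSpace F] [T2Space F] [Zero F] {f : ℝ → F}
    (hcd : c < d) (hf : Continuous f) (h : ∀ s ∈ Ioo c d, f s = 0) : ∀ s ∈ Icc c d, f s = 0 := by
  have hcl : IsClosed {s | f s = 0} := isClosed_eq hf continuous_const
  have := closure_minimal (show Ioo c d ⊆ {s | f s = 0} from h) hcl
  rw [closure_Ioo hcd.ne] at this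
  exact this

/-- Inside the interval the function is locally zero along `s`; continuity of the derivative covers
the end points. -/
theorem dirD_es_eq_zero_on_Icc {f : ℝ × ℝ × ℝ → ℝ} (hcd : c < d) (hf : ContDiff ℝ ∞ f) {x β : ℝ}
    (h : ∀ s ∈ Icc c d, f (s, x, β) = 0) : ∀ s ∈ Icc c d, dirD es f (s, x, β) = 0 := by
  refine eq_zero_on_Icc hcd ((contDiff_dirD hf es).continuous.comp (by fun_prop)) fun s hs => ?_
  refine (hasDerivAt_slot_s (hf.differentiable (by simp)) s x β).unique ?_
  refine (hasDerivAt_const s (0 : ℝ)).congr_of_eventuallyEq ?_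
  filter_upwards [isOpen_Ioo.mem_nhds hs] with s' hs' using h s' (Ioo_subset_Icc_self hs')

theorem isoForm_comm (X Y : Matrix (Fin 2) (Fin 2) ℝ) :
    isoForm lam mu X Y = isoForm lam mu Y X := by
  unfold isoForm; ring

theorem continuous_isoForm {X Y : ℝ → Matrix (Fin 2) (Fin 2) ℝ}
    (hX : ∀ i j, ContDiff ℝ ∞ fun s => X s i j) (hY : ∀ i j, ContDiff ℝ ∞ fun s => Y s i j) :
    Continuous fun s => isoForm lam mu (X s) (Y s) := by
  have h1 := fun i j => (hX i j).continuous
  have h2 := fun i j => (hY i j).continuous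
  unfold isoForm
  fun_prop

/-- The derivative of the strain of the family in the direction `v` at the center curve in the
limit of vanishing breadth. -/
noncomputable def strainD (S : CenteredStrip) (Q : ℝ × ℝ × ℝ → Plane) (v : ℝ × ℝ × ℝ) (s : ℝ) :
    Matrix (Fin 2) (Fin 2) ℝ :=
  Matrix.of fun i j => dirD v (fun t => familyStrain S Q t i j) (s, 0, 0)

/-- The second derivatives of the strain of the family at the center curve in the limit of
vanishing breadth. -/
noncomputable def strainD2 (S : CenteredStrip) (Q : ℝ × ℝ × ℝ → Plane) (v w : ℝ × ℝ × ℝ) (s : ℝ) :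
    Matrix (Fin 2) (Fin 2) ℝ :=
  Matrix.of fun i j => dirD v (dirD w (fun t => familyStrain S Q t i j)) (s, 0, 0)

theorem familyStrain_symm_fun (i j : Fin 2) :
    (fun t => familyStrain S Q t j i) = fun t => familyStrain S Q t i j :=
  funext fun t => familyStrain_symm t i j

namespace IsMinimizingFamily

variable (h : IsMinimizingFamily S C k c d p Q)
include h

/-- The Euler–Lagrange integrand `G` in the form used at both orders. The approximation `L` of the
strain and its order `m` are left free, and the factor 2 collects the two orders of the pairing. -/
theorem exists_tested_density (hC : C.IsIsotropic S lam mu)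
    (hCpos : C.IsPositive S) {φ : ℝ → ℝ} (hφ : ContDiff ℝ ∞ φ) (hφ0 : ∀ s, s ∉ Ioo c d → φ s = 0)
    {a b : ℝ → Matrix (Fin 2) (Fin 2) ℝ} (ha : ∀ i j, ContDiff ℝ ∞ fun s => a s i j)
    (hb : ∀ i j, ContDiff ℝ ∞ fun s => b s i j) (ha' : ∀ s, a s 1 0 = a s 0 1)
    (hb' : ∀ s, b s 1 0 = b s 0 1) :
    ∃ G : ℝ × ℝ × ℝ → ℝ,
      (∀ β ∈ Ioc (0 : ℝ) 1,
        IntegrableOn (fun u : ℝ × ℝ => G (u.1, u.2, β)) (stripDomain c d S.B β)) ∧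
      (∀ β ∈ Ioc (0 : ℝ) 1, ∫ u in stripDomain c d S.B β, G (u.1, u.2, β) = 0) ∧
      ∀ (m : ℕ) (L : ℝ × ℝ × ℝ → Matrix (Fin 2) (Fin 2) ℝ),
        (∀ i j, ThinO c d S.B (m + 1) fun t => familyStrain S Q t i j - L t i j) →
        (∀ i j, ThinO c d S.B m fun t => L t i j) →
        ThinO c d S.B (m + 2) fun t => G t -
          2 * φ t.1 * isoForm lam mu (L t) (t.2.1 • a t.1 + t.2.2 • b t.1) := by
  obtain ⟨V, hVc, hVO, hV⟩ := h.exists_test hC hCpos hφ hφ0 ha hb ha' hb'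
  refine ⟨fun t => (C.pair (t.1, t.2.1) (familyStrain S Q t) (V t) +
    C.pair (t.1, t.2.1) (V t) (familyStrain S Q t)) * Real.sqrt (S.g (t.1, t.2.1)).det,
    fun β hβ => ?_, hV, fun m L hL hL0 => ?_⟩
  · have hslice : Continuous fun u : ℝ × ℝ => ((u.1, u.2, β) : ℝ × ℝ × ℝ) := by fun_prop
    have hE := (continuous_familyStrain (S := S) h.smooth).comp hslice
    have hV' := hVc.comp hslice
    have hc := ((hC.continuousOn_pair hβ.2 hE hV').add (hC.continuousOn_pair hβ.2 hV' hE)).mono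
      (stripDomain_subset_D h.subset)
    refine IntegrableOn.congr_fun (hc.integrableOn_compact
      (isCompact_stripDomain h.B_cont h.B_pos hβ.1)) (fun u _ => ?_)
      (isCompact_stripDomain h.B_cont h.B_pos hβ.1).measurableSet
    simp only [Function.comp_apply, Pi.add_apply, add_mul]
  · set M : ℝ × ℝ × ℝ → Matrix (Fin 2) (Fin 2) ℝ := fun t =>
      φ t.1 • (t.2.1 • a t.1 + t.2.2 • b t.1) with hM
    have hVM : ∀ i j, ThinO c d S.B (1 + 1) fun t => V t i j - M t i j := hVO
    have hM1 : ∀ i j, ThinO c d S.B 1 fun t => M t i j := by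
      intro i j
      have o1 := fun (f : ℝ → ℝ) (hf : ContDiff ℝ ∞ f) =>
        smooth_thinO_zero h.B_cont (hf.comp (contDiff_fst (F := ℝ × ℝ)))
      exact (o1 φ hφ).mul_le (((thinO_x h.B_cont).mul (o1 _ (ha i j))).add
        (thinO_beta.mul (o1 _ (hb i j)))) (by norm_num)
    have e1 := thinO_pair hC h.subset hL hL0 hVM hM1
    have e2 := (thinO_pair hC h.subset hVM hM1 hL hL0).mono (n := m + 1 + 1) (by omega)
    refine (e1.add e2).congr fun t _ => ?_
    rw [isoForm_comm (M t) (L t)]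
    have : isoForm lam mu (L t) (M t) =
        φ t.1 * isoForm lam mu (L t) (t.2.1 • a t.1 + t.2.2 • b t.1) := by
      simp only [hM, isoForm, Matrix.smul_apply, smul_eq_mul]
      ring
    rw [this]
    ring

theorem contDiff_strainD (v : ℝ × ℝ × ℝ) (i j : Fin 2) :
    ContDiff ℝ ∞ fun s => strainD S Q v s i j :=
  contDiff_atCenter (contDiff_dirD (contDiff_familyStrain h.smooth i j) v)

theorem contDiff_strainD2 (v w : ℝ × ℝ × ℝ) (i j : Fin 2) :
    ContDiff ℝ ∞ fun s => strainD2 S Q v w s i j :=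
  contDiff_atCenter (contDiff_dirD (contDiff_dirD (contDiff_familyStrain h.smooth i j) w) v)

/-- The variation is chosen so that its strain is `φ` times the first-order part of `E`. The tested
integrand is then a weighted square; its mixed term is odd in `x`, and the even coefficients are the
squares of `E_β` and `E_x`. -/
theorem strainD_eq_zero (hC : C.IsIsotropic S lam mu) (hCpos : C.IsPositive S) :
    ∀ s ∈ Icc c d, strainD S Q ex s = 0 ∧ strainD S Q eb s = 0 := by
  obtain ⟨φ, hφ, hφn, hφpos, hφ0⟩ := exists_smooth_bump c d
  have hD := h.contDiff_strainD
  have hE0 := h.familyStrain_center hC hCpos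
  have hsymm : ∀ v s i j, strainD S Q v s j i = strainD S Q v s i j := by
    intro v s i j
    simp only [strainD, Matrix.of_apply, familyStrain_symm_fun i j]
  have hSymm : ∀ v s, (strainD S Q v s).IsSymm := fun v s => by ext i j; exact hsymm v s _ _
  obtain ⟨G, hGi, hG0, hGO⟩ := h.exists_tested_density hC hCpos hφ hφ0 (hD ex) (hD eb)
    (fun s => hsymm ex s 0 1) (fun s => hsymm eb s 0 1)
  have o1 := fun (f : ℝ → ℝ) (hf : ContDiff ℝ ∞ f) =>
    smooth_thinO_zero h.B_cont (hf.comp (contDiff_fst (F := ℝ × ℝ)))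
  -- The leading part has degree two in `(x, β)`; the factor `β` makes it cubic.
  have hO := thinO_beta.mul (hGO 1
    (fun t => t.2.1 • strainD S Q ex t.1 + t.2.2 • strainD S Q eb t.1)
    (fun i j => (taylor_two h.B_cont (contDiff_familyStrain h.smooth i j)).congr fun t ht => by
      rw [hE0 t.1 ht.2.1]
      simp [strainD])
    (fun i j => ((thinO_x h.B_cont).mul (o1 _ (hD ex i j))).add
        (thinO_beta.mul (o1 _ (hD eb i j)))))
  have key := even_coeff_eq_zero (K := 0) h.lt h.B_cont h.B_pos
    (p₀ := fun s => 2 * φ s * isoForm lam mu (strainD S Q eb s) (strainD S Q eb s))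
    (p₁ := fun s => 4 * φ s * isoForm lam mu (strainD S Q ex s) (strainD S Q eb s))
    (p₂ := fun s => 2 * φ s * isoForm lam mu (strainD S Q ex s) (strainD S Q ex s))
    (p₃ := fun _ => 0) (G := fun t => t.2.2 * G t)
    ((hφ.continuous.const_mul 2).mul (continuous_isoForm (hD eb) (hD eb)))
    ((hφ.continuous.const_mul 4).mul (continuous_isoForm (hD ex) (hD eb)))
    ((hφ.continuous.const_mul 2).mul (continuous_isoForm (hD ex) (hD ex))) continuous_const
    (fun s _ => mul_nonneg (mul_nonneg zero_le_two (hφn s)) (hCpos.isoForm_nonneg hC (hSymm _ s)))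
    (fun s _ => mul_nonneg (mul_nonneg zero_le_two (hφn s)) (hCpos.isoForm_nonneg hC (hSymm _ s)))
    (fun β hβ => Integrable.const_mul (hGi β hβ) β)
    (hO.congr fun t _ => by
      simp only [isoForm, Matrix.add_apply, Matrix.smul_apply, smul_eq_mul]
      ring)
    (fun β hβ => by
      rw [integral_const_mul, hG0 β hβ]
      simp)
  have hint : ∀ s ∈ Ioo c d, strainD S Q ex s = 0 ∧ strainD S Q eb s = 0 := by
    intro s hs
    obtain ⟨k1, k2⟩ := key s (Ioo_subset_Icc_self hs)
    have hne : 2 * φ s ≠ 0 := (mul_pos two_pos (hφpos s hs)).ne'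
    exact ⟨hCpos.eq_zero hC (hSymm _ s) ((mul_eq_zero.1 k2).resolve_left hne),
      hCpos.eq_zero hC (hSymm _ s) ((mul_eq_zero.1 k1).resolve_left hne)⟩
  have hc : ∀ v, Continuous (strainD S Q v) := fun v =>
    continuous_matrix fun i j => (hD v i j).continuous
  intro s hs
  exact ⟨eq_zero_on_Icc h.lt (hc ex) (fun s hs => (hint s hs).1) s hs,
    eq_zero_on_Icc h.lt (hc eb) (fun s hs => (hint s hs).2) s hs⟩

/-- Testing with `x E_{xβ}` pairs `E_xx` with `x³` and `E_ββ` with `β² x`, both odd. Only `E_{xβ}`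
meets the even power `β x²`, so it alone is controlled, which is all that the curvature estimate
requires. -/
theorem strainD2_eq_zero (hC : C.IsIsotropic S lam mu) (hCpos : C.IsPositive S) :
    ∀ s ∈ Icc c d, strainD2 S Q ex eb s = 0 := by
  obtain ⟨φ, hφ, hφn, hφpos, hφ0⟩ := exists_smooth_bump c d
  have hD := h.contDiff_strainD2
  have hE0 := h.familyStrain_center hC hCpos
  have hE1 := h.strainD_eq_zero hC hCpos
  have hsymm : ∀ s i j, strainD2 S Q ex eb s j i = strainD2 S Q ex eb s i j := by
    intro s i j
    simp only [strainD2, Matrix.of_apply, familyStrain_symm_fun i j]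
  have hSymm : ∀ s, (strainD2 S Q ex eb s).IsSymm := fun s => by ext i j; exact hsymm s _ _
  obtain ⟨G, hGi, hG0, hGO⟩ := h.exists_tested_density (b := fun _ => 0) hC hCpos hφ hφ0 (hD ex eb)
    (fun _ _ => contDiff_const) (fun s => hsymm s 0 1) (fun s => rfl)
  have o1 := fun (f : ℝ → ℝ) (hf : ContDiff ℝ ∞ f) =>
    smooth_thinO_zero h.B_cont (hf.comp (contDiff_fst (F := ℝ × ℝ)))
  have ox := thinO_x h.B_cont
  have ob := thinO_beta (c := c) (d := d) (B := S.B)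
  have hO := hGO 2
    (fun t => (t.2.1 * t.2.1 / 2) • strainD2 S Q ex ex t.1 +
      (t.2.1 * t.2.2) • strainD2 S Q ex eb t.1 + (t.2.2 * t.2.2 / 2) • strainD2 S Q eb eb t.1)
    (fun i j => (taylor_three h.B_cont (contDiff_familyStrain h.smooth i j)).congr fun t ht => by
      have e1 := congrArg (fun M : Matrix (Fin 2) (Fin 2) ℝ => M i j) (hE1 t.1 ht.2.1).1
      have e2 := congrArg (fun M : Matrix (Fin 2) (Fin 2) ℝ => M i j) (hE1 t.1 ht.2.1).2
      simp only [strainD, Matrix.of_apply, Matrix.zero_apply] at e1 e2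
      rw [hE0 t.1 ht.2.1, e1, e2]
      simp only [strainD2, Matrix.add_apply, Matrix.smul_apply, smul_eq_mul, Matrix.of_apply,
        Matrix.zero_apply]
      ring)
    (fun i j => (((((ox.mul ox).mul (o1 _ (hD ex ex i j))).const_mul (1 / 2)).add
      ((ox.mul ob).mul (o1 _ (hD ex eb i j)))).add
      (((ob.mul ob).mul (o1 _ (hD eb eb i j))).const_mul (1 / 2))).congr fun t _ => by
        simp only [Matrix.add_apply, Matrix.smul_apply, smul_eq_mul, Function.comp_apply]
        ring)
  have key := even_coeff_eq_zero (K := 0) h.lt h.B_cont h.B_pos (p₀ := fun _ => 0)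
    (p₁ := fun s => φ s * isoForm lam mu (strainD2 S Q eb eb s) (strainD2 S Q ex eb s))
    (p₂ := fun s => 2 * φ s * isoForm lam mu (strainD2 S Q ex eb s) (strainD2 S Q ex eb s))
    (p₃ := fun s => φ s * isoForm lam mu (strainD2 S Q ex ex s) (strainD2 S Q ex eb s))
    (G := G) continuous_const
    (hφ.continuous.mul (continuous_isoForm (hD eb eb) (hD ex eb)))
    ((hφ.continuous.const_mul 2).mul (continuous_isoForm (hD ex eb) (hD ex eb)))
    (hφ.continuous.mul (continuous_isoForm (hD ex ex) (hD ex eb)))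
    (fun s _ => le_rfl)
    (fun s _ => mul_nonneg (mul_nonneg zero_le_two (hφn s)) (hCpos.isoForm_nonneg hC (hSymm s)))
    hGi
    (hO.congr fun t _ => by
      simp only [isoForm, Matrix.add_apply, Matrix.smul_apply, smul_eq_mul, Matrix.zero_apply]
      ring)
    (fun β hβ => by
      rw [hG0 β hβ]
      simp)
  refine eq_zero_on_Icc h.lt (continuous_matrix fun i j => (hD ex eb i j).continuous)
    fun s hs => ?_
  have hne : 2 * φ s ≠ 0 := (mul_pos two_pos (hφpos s hs)).ne'
  exact hCpos.eq_zero hC (hSymm s)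
    ((mul_eq_zero.1 (key s (Ioo_subset_Icc_self hs)).2).resolve_left hne)

end IsMinimizingFamily

end Stages

/-! ### Curvature of the center curve and the final estimate -/

section Curvature

variable {S : CenteredStrip} {C : StiffnessField} {lam mu c d : ℝ} {k : ℕ∞}
  {p : ℝ → ℝ × ℝ → Plane} {Q : ℝ × ℝ × ℝ → Plane}

theorem pd_chart {F : Type*} [NormedAddCommGroup F] [NormedSpace ℝ F] {f : ℝ × ℝ → F}
    (hf : ContDiff ℝ ∞ f) (i : Fin 2) (t : ℝ × ℝ × ℝ) :
    dirD (chartDir i) (fun t : ℝ × ℝ × ℝ => f (t.1, t.2.1)) t = pd i f (t.1, t.2.1) := by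
  rw [← pd_slice ((contDiff_chart hf).differentiable (by simp)) t.2.2 i (t.1, t.2.1)]

theorem CenteredStrip.pd_zero_g_center (S : CenteredStrip) (hcd : c < d)
    (hJ : Icc c d ⊆ Icc S.a S.b) (i j : Fin 2) {s : ℝ} (hs : s ∈ Icc c d) :
    pd 0 (fun u => S.g u i j) (s, 0) = 0 := by
  have h1 := dirD_es_eq_zero_on_Icc (x := 0) (β := 0) hcd
    (f := fun t => S.g (t.1, t.2.1) i j - (1 : Matrix (Fin 2) (Fin 2) ℝ) i j)
    ((contDiff_chart (S.g_smooth i j)).sub contDiff_const)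
    (fun s hs => by simp only [S.g_center s (hJ hs), sub_self]) s hs
  have h2 : dirD es (fun t : ℝ × ℝ × ℝ => S.g (t.1, t.2.1) i j -
      (1 : Matrix (Fin 2) (Fin 2) ℝ) i j) (s, 0, 0) =
      dirD es (fun t : ℝ × ℝ × ℝ => S.g (t.1, t.2.1) i j) (s, 0, 0) := by
    unfold dirD
    rw [fderiv_sub_const]
  rw [h2] at h1
  have h3 := pd_chart (S.g_smooth i j) 0 (s, 0, 0)
  exact h3.symm.trans h1

/-- On the center curve the metric is the identity and its `s`-derivatives vanish, so the only
Christoffel symbol that contributes reduces to `-∂ₓg₀₀ / 2`. -/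
theorem CenteredStrip.centerCurvature_eq (S : CenteredStrip) (hcd : c < d)
    (hJ : Icc c d ⊆ Icc S.a S.b) {s : ℝ} (hs : s ∈ Icc c d) :
    S.centerCurvature s = -(1 / 2) * pd 1 (fun u => S.g u 0 0) (s, 0) := by
  have hv : ∀ t i, velocity (fun t : ℝ => (t, (0 : ℝ))) t i = if i = 0 then 1 else 0 := by
    intro t i
    fin_cases i <;> simp [velocity, comp]
  have hg : S.g (s, 0) = 1 := S.g_center s (hJ hs)
  have hpd := fun i j => S.pd_zero_g_center hcd hJ i j hs
  simp only [CenteredStrip.centerCurvature, geodesicCurvature, covAccel, hv, christoffel, hg,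
    Fin.sum_univ_two, inv_one]
  simp [hpd]

/-- The curvature of a plane curve with velocity `A` and acceleration `A'` in terms of the scalar
products with a second vector `D` for which `(A, D)` is positively oriented and nearly
orthonormal. -/
theorem abs_curvature_sub_le {A A' D : Plane} {e k₀ K₀ ρ q x y z : ℝ} (he : e ≤ 1 / 8)
    (hdet : 0 < det2 A D) (hAA : (inner ℝ A A : ℝ) = 1 + 2 * x) (hAD : (inner ℝ A D : ℝ) = 2 * y)
    (hDD : (inner ℝ D D : ℝ) = 1 + 2 * z) (hA'D : (inner ℝ A' D : ℝ) = k₀ + ρ)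
    (hAA' : (inner ℝ A A' : ℝ) = q) (hx : |x| ≤ e) (hy : |y| ≤ e) (hz : |z| ≤ e) (hρ : |ρ| ≤ e)
    (hk₀ : |k₀| ≤ K₀) (hq : |q| ≤ K₀) :
    |det2 A A' / ‖A‖ ^ 3 - k₀| ≤ (40 * K₀ + 4) * e := by
  have hn2 : ‖A‖ ^ 2 = 1 + 2 * x := by rw [← real_inner_self_eq_norm_sq, hAA]
  have he0 : 0 ≤ e := (abs_nonneg _).trans hx
  have hK0 : 0 ≤ K₀ := (abs_nonneg _).trans hk₀
  have hx' := abs_le.1 hx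
  have hy' := abs_le.1 hy
  have hz' := abs_le.1 hz
  have hn : 0 < ‖A‖ := by
    have := norm_nonneg A
    rcases this.lt_or_eq with h | h
    · exact h
    · rw [← h] at hn2; norm_num at hn2; linarith
  -- Lagrange's identity `det(A, A') det(A, D) = |A|² ⟨A', D⟩ - ⟨A, D⟩ ⟨A, A'⟩`; `hdet2` below is
  -- the case `A' = D`.
  have hlag : det2 A A' * det2 A D = (1 + 2 * x) * (k₀ + ρ) - 2 * y * q := by
    rw [← hAA, ← hA'D, ← hAD, ← hAA']
    simp only [inner_plane, det2]
    ring
  have hdet2 : det2 A D ^ 2 = (1 + 2 * x) * (1 + 2 * z) - (2 * y) ^ 2 := by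
    rw [← hAA, ← hDD, ← hAD]
    simp only [inner_plane, det2]
    ring
  set n := ‖A‖
  set D₀ := det2 A D
  set N := det2 A A'
  have hDn : 0 < D₀ * n := mul_pos hdet hn
  have hy2 : y ^ 2 ≤ e ^ 2 := sq_le_sq' hy'.1 hy'.2
  have hsq : |(D₀ * n) ^ 2 - 1| ≤ 10 * e := by
    have e1 : (D₀ * n) ^ 2 - 1 = 2 * x + 2 * z + 4 * (x * z) +
        2 * x * ((1 + 2 * x) * (1 + 2 * z)) - 4 * y ^ 2 * (1 + 2 * x) := by
      rw [mul_pow, hdet2, hn2]; ring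
    have hxz : |x * z| ≤ e * (1 / 8) := by
      rw [abs_mul]; exact mul_le_mul hx (hz.trans he) (abs_nonneg _) he0
    have hp : |(1 + 2 * x) * (1 + 2 * z)| ≤ 25 / 16 := by
      rw [abs_mul, abs_of_pos (show 0 < 1 + 2 * x by linarith),
        abs_of_pos (show 0 < 1 + 2 * z by linarith)]
      refine (mul_le_mul (b := 5 / 4) (d := 5 / 4) (by linarith) (by linarith) (by linarith)
        (by norm_num)).trans (by norm_num)
    have hxp : |x * ((1 + 2 * x) * (1 + 2 * z))| ≤ e * (25 / 16) := by
      rw [abs_mul]; exact mul_le_mul hx hp (abs_nonneg _) he0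
    have hyp : y ^ 2 * (1 + 2 * x) ≤ e * (1 / 8) * (5 / 4) := by
      refine mul_le_mul (hy2.trans ?_) (by linarith) (by linarith) (by positivity)
      rw [sq]
      exact mul_le_mul_of_nonneg_left he he0
    have hyp0 : 0 ≤ y ^ 2 * (1 + 2 * x) := mul_nonneg (sq_nonneg y) (by linarith)
    have b1 := abs_le.1 hxz
    have b2 := abs_le.1 hxp
    rw [e1, abs_le]
    constructor <;> linarith
  have h1 : |1 - D₀ * n| ≤ 10 * e := by
    refine le_trans ?_ hsq
    have : (D₀ * n) ^ 2 - 1 = -((1 - D₀ * n) * (D₀ * n + 1)) := by ring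
    rw [this, abs_neg, abs_mul, abs_of_pos (show 0 < D₀ * n + 1 by linarith)]
    exact le_mul_of_one_le_right (abs_nonneg _) (by linarith)
  -- From `e ≤ 1/8`: `D₀² ≥ 9/16 - 1/16` and `n⁶ ≥ (3/4)³`, whose product exceeds `(2/5)²`. Dividing
  -- the numerator bound below by `2/5` leads, after rounding up, to the constants 40 and 4.
  have hden : 2 / 5 ≤ D₀ * n ^ 3 := by
    have hD2 : 1 / 2 ≤ D₀ ^ 2 := by
      have m1 : (3 / 4 : ℝ) * (3 / 4) ≤ (1 + 2 * x) * (1 + 2 * z) :=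
        mul_le_mul (by linarith) (by linarith) (by norm_num) (by linarith)
      have m2 : e ^ 2 ≤ (1 / 8) ^ 2 := pow_le_pow_left₀ he0 he 2
      rw [hdet2, mul_pow]
      linarith
    have hn6 : 27 / 64 ≤ n ^ 6 := by
      have : n ^ 6 = (n ^ 2) ^ 3 := by ring
      rw [this, hn2]
      have h34 : (3 / 4 : ℝ) ≤ 1 + 2 * x := by linarith
      calc (27 / 64 : ℝ) = (3 / 4) ^ 3 := by norm_num
        _ ≤ (1 + 2 * x) ^ 3 := pow_le_pow_left₀ (by norm_num) h34 3
    have hsq' : (2 / 5 : ℝ) ^ 2 ≤ (D₀ * n ^ 3) ^ 2 := by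
      have : (D₀ * n ^ 3) ^ 2 = D₀ ^ 2 * n ^ 6 := by ring
      have m3 : (1 / 2 : ℝ) * (27 / 64) ≤ D₀ ^ 2 * n ^ 6 :=
        mul_le_mul hD2 hn6 (by norm_num) (sq_nonneg _)
      rw [this]
      linarith
    exact le_of_sq_le_sq hsq' (by positivity)
  have hden0 : 0 < D₀ * n ^ 3 := by linarith
  have hrepr : N / n ^ 3 - k₀ =
      ((1 + 2 * x) * k₀ * (1 - D₀ * n) + (1 + 2 * x) * ρ - 2 * y * q) / (D₀ * n ^ 3) := by
    rw [eq_div_iff hden0.ne', sub_mul, div_mul_eq_mul_div, div_sub' (by positivity),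
      div_eq_iff (by positivity)]
    have : n ^ 3 * (k₀ * (D₀ * n ^ 3)) = n ^ 3 * (k₀ * (D₀ * n) * (1 + 2 * x)) := by
      rw [← hn2]; ring
    rw [this]
    linear_combination n ^ 3 * hlag
  have hnum : |(1 + 2 * x) * k₀ * (1 - D₀ * n) + (1 + 2 * x) * ρ - 2 * y * q| ≤
      (29 / 2 * K₀ + 5 / 4) * e := by
    have hx1 : |1 + 2 * x| ≤ 5 / 4 := by rw [abs_of_pos (by linarith)]; linarith
    have t1 : |(1 + 2 * x) * k₀ * (1 - D₀ * n)| ≤ 5 / 4 * K₀ * (10 * e) := by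
      rw [abs_mul, abs_mul]; gcongr
    have t2 : |(1 + 2 * x) * ρ| ≤ 5 / 4 * e := by rw [abs_mul]; gcongr
    have t3 : |2 * y * q| ≤ 2 * e * K₀ := by
      rw [abs_mul, abs_mul, abs_two]; gcongr
    have s1 := abs_le.1 t1
    have s2 := abs_le.1 t2
    have s3 := abs_le.1 t3
    rw [abs_le]
    constructor <;> linarith
  rw [hrepr, abs_div, abs_of_pos hden0, div_le_iff₀ hden0]
  refine hnum.trans ?_
  have : (40 * K₀ + 4) * e * (2 / 5) ≤ (40 * K₀ + 4) * e * (D₀ * n ^ 3) :=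
    mul_le_mul_of_nonneg_left hden (by positivity)
  have hKe := mul_nonneg hK0 he0
  linarith

namespace IsMinimizingFamily

variable (h : IsMinimizingFamily S C k c d p Q)
include h

theorem planarCurvature_eq {β : ℝ} (hβ : β ∈ Ioc (0 : ℝ) 1) {s : ℝ} (hs : s ∈ Icc c d) :
    planarCurvature (Icc c d) (fun x => p β (x, 0)) s =
      det2 (frame Q 0 (s, 0, β)) (dirD es (frame Q 0) (s, 0, β)) /
        ‖frame Q 0 (s, 0, β)‖ ^ 3 := by
  have hu : UniqueDiffOn ℝ (Icc c d) := uniqueDiffOn_Icc h.lt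
  have h0 : ∀ s ∈ Icc c d, p β (s, 0) = Q (s, 0, β) := fun s hs =>
    h.eq β hβ (s, 0) (stripDomain_subset_D h.subset
      (center_mem_stripDomain h.B_pos hβ.1.le hs)) hs
  have h1 : ∀ s ∈ Icc c d, derivWithin (fun x => p β (x, 0)) (Icc c d) s =
      frame Q 0 (s, 0, β) := by
    intro s hs
    rw [derivWithin_congr h0 (h0 s hs)]
    exact (hasDerivAt_slot_s (h.smooth.differentiable (by simp)) s 0 β).hasDerivWithinAt.derivWithin
      (hu s hs)
  have h2 : derivWithin (derivWithin (fun x => p β (x, 0)) (Icc c d)) (Icc c d) s =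
      dirD es (frame Q 0) (s, 0, β) := by
    rw [derivWithin_congr h1 (h1 s hs)]
    exact (hasDerivAt_slot_s ((contDiff_frame h.smooth 0).differentiable
      (by simp)) s 0 β).hasDerivWithinAt.derivWithin (hu s hs)
  rw [planarCurvature, h1 s hs, h2]

theorem inner_frame {β : ℝ} {s : ℝ} (hs : s ∈ Icc c d) (i j : Fin 2) :
    (inner ℝ (frame Q i (s, 0, β)) (frame Q j (s, 0, β)) : ℝ) =
      (1 : Matrix (Fin 2) (Fin 2) ℝ) i j + 2 * familyStrain S Q (s, 0, β) i j := by
  have : (1 : Matrix (Fin 2) (Fin 2) ℝ) j i = (1 : Matrix (Fin 2) (Fin 2) ℝ) i j := by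
    rw [Matrix.one_apply, Matrix.one_apply]; simp only [eq_comm]
  simp only [familyStrain, Matrix.of_apply, S.g_center s (h.subset hs), this]
  ring

theorem dirD_inner_frame (i j l : Fin 2) (t : ℝ × ℝ × ℝ) :
    dirD (chartDir l) (fun t => (inner ℝ (frame Q i t) (frame Q j t) : ℝ)) t =
      2 * dirD (chartDir l) (fun t => familyStrain S Q t i j) t +
        (pd l (fun u => S.g u i j) (t.1, t.2.1) + pd l (fun u => S.g u j i) (t.1, t.2.1)) / 2 := by
  have e : (fun t => (inner ℝ (frame Q i t) (frame Q j t) : ℝ)) =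
      fun t => 2 * familyStrain S Q t i j +
        (1 / 2 * S.g (t.1, t.2.1) i j + 1 / 2 * S.g (t.1, t.2.1) j i) := by
    funext t
    simp only [familyStrain, Matrix.of_apply]
    ring
  have d0 := ((contDiff_familyStrain (S := S) h.smooth i j).differentiable (by simp) t).hasFDerivAt
  have d1 := ((contDiff_chart (S.g_smooth i j)).differentiable (by simp) t).hasFDerivAt
  have d2 := ((contDiff_chart (S.g_smooth j i)).differentiable (by simp) t).hasFDerivAt
  have d3 := (d0.const_mul 2).add ((d1.const_mul (1 / 2)).add (d2.const_mul (1 / 2)))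
  rw [← pd_chart (S.g_smooth i j) l t, ← pd_chart (S.g_smooth j i) l t, e]
  unfold dirD
  have := congrArg (fun A => A (chartDir l)) d3.fderiv
  refine this.trans ?_
  simp only [add_apply, smul_apply, smul_eq_mul]
  ring

/-- With `A` and `D` the two frame vectors, `∂ₛD = ∂ₓA` gives `⟨∂ₛA, D⟩ = ∂ₛ⟨A, D⟩ - ∂ₓ|A|² / 2`.
The scalar products equal `g + 2E`: the part from `g` is the reference curvature, the part from `E`
is the correction. -/
theorem inner_acceleration {β : ℝ} {s : ℝ} (hs : s ∈ Icc c d) :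
    (inner ℝ (dirD es (frame Q 0) (s, 0, β)) (frame Q 1 (s, 0, β)) : ℝ) =
      S.centerCurvature s + (2 * dirD es (fun t => familyStrain S Q t 0 1) (s, 0, β) -
        dirD ex (fun t => familyStrain S Q t 0 0) (s, 0, β)) := by
  have hfd : ∀ i, Differentiable ℝ (frame Q i) := fun i =>
    (contDiff_frame h.smooth i).differentiable (by simp)
  have h01 := h.dirD_inner_frame 0 1 0 (s, 0, β)
  have h00 := h.dirD_inner_frame 0 0 1 (s, 0, β)
  rw [dirD_inner (hfd 0) (hfd 1)] at h01
  rw [dirD_inner (hfd 0) (hfd 0), real_inner_comm (frame Q 0 (s, 0, β))] at h00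
  simp only [S.pd_zero_g_center h.lt h.subset _ _ hs] at h01
  have hcomm : dirD (chartDir 0) (frame Q 1) = dirD (chartDir 1) (frame Q 0) :=
    dirD_comm h.smooth _ _
  rw [hcomm] at h01
  rw [S.centerCurvature_eq h.lt h.subset hs]
  change _ = _ + (2 * dirD (chartDir 0) (fun t => familyStrain S Q t 0 1) (s, 0, β) -
    dirD (chartDir 1) (fun t => familyStrain S Q t 0 0) (s, 0, β))
  change (inner ℝ (dirD (chartDir 0) (frame Q 0) (s, 0, β)) (frame Q 1 (s, 0, β)) : ℝ) = _
  linarith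

theorem abs_le_of_taylor {f : ℝ × ℝ × ℝ → ℝ} (hf : ContDiff ℝ ∞ f)
    (h0 : ∀ s ∈ Icc c d, f (s, 0, 0) = 0) (hb : ∀ s ∈ Icc c d, dirD eb f (s, 0, 0) = 0) :
    ∃ K : ℝ, 0 ≤ K ∧ ∀ β ∈ Ioc (0 : ℝ) 1, ∀ s ∈ Icc c d, |f (s, 0, β)| ≤ K * β ^ 2 := by
  obtain ⟨K, hK0, hK⟩ := (taylor_two h.B_cont hf).exists_nonneg
  refine ⟨K, hK0, fun β hβ s hs => ?_⟩
  have := hK (s, 0, β) ⟨hβ, center_mem_stripDomain h.B_pos hβ.1.le hs⟩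
  simpa [h0 s hs, hb s hs] using this

/-- The metric and the curvature of the center curve of the minimizers agree with those of the
reference state up to terms of second order in `β`. -/
theorem second_order (hC : C.IsIsotropic S lam mu) (hCpos : C.IsPositive S) :
    ∃ M : ℝ, ∀ᶠ β in 𝓝[>] (0 : ℝ), ∀ s ∈ Icc c d,
      (∀ i j : Fin 2, |inducedMetric (p β) (s, 0) i j - S.g (s, 0) i j| ≤ M * β ^ 2) ∧
      |planarCurvature (Icc c d) (fun x => p β (x, 0)) s - S.centerCurvature s| ≤ M * β ^ 2 := by
  have hEs := contDiff_familyStrain (S := S) h.smooth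
  have hE0 : ∀ i j, ∀ s ∈ Icc c d, familyStrain S Q (s, 0, 0) i j = 0 := fun i j s hs =>
    congrArg (fun M : Matrix (Fin 2) (Fin 2) ℝ => M i j) (h.familyStrain_center hC hCpos s hs)
  have hEx : ∀ i j, ∀ s ∈ Icc c d, dirD ex (fun t => familyStrain S Q t i j) (s, 0, 0) = 0 :=
    fun i j s hs => congrArg (fun M : Matrix (Fin 2) (Fin 2) ℝ => M i j)
      (h.strainD_eq_zero hC hCpos s hs).1
  have hEb : ∀ i j, ∀ s ∈ Icc c d, dirD eb (fun t => familyStrain S Q t i j) (s, 0, 0) = 0 :=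
    fun i j s hs => congrArg (fun M : Matrix (Fin 2) (Fin 2) ℝ => M i j)
      (h.strainD_eq_zero hC hCpos s hs).2
  have hExb : ∀ i j, ∀ s ∈ Icc c d,
      dirD ex (dirD eb (fun t => familyStrain S Q t i j)) (s, 0, 0) = 0 :=
    fun i j s hs => congrArg (fun M : Matrix (Fin 2) (Fin 2) ℝ => M i j)
      (h.strainD2_eq_zero hC hCpos s hs)
  choose K hK0 hK using fun i j => h.abs_le_of_taylor (hEs i j) (hE0 i j) (hEb i j)
  -- The bound for `∂ₓE₀₀` is where `E_{xβ} = 0` is needed; without it the curvature error would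
  -- only be `O(β)`.
  obtain ⟨K₁, hK₁0, hK₁⟩ := h.abs_le_of_taylor (contDiff_dirD (hEs 0 0) ex) (hEx 0 0)
    (fun s hs => by rw [dirD_comm (hEs 0 0)]; exact hExb 0 0 s hs)
  obtain ⟨K₂, hK₂0, hK₂⟩ := h.abs_le_of_taylor (contDiff_dirD (hEs 0 1) es)
    (dirD_es_eq_zero_on_Icc h.lt (hEs 0 1) (hE0 0 1))
    (fun s hs => by
      rw [dirD_comm (hEs 0 1)]
      exact dirD_es_eq_zero_on_Icc h.lt (contDiff_dirD (hEs 0 1) eb) (hEb 0 1) s hs)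
  obtain ⟨K₃, hK₃0, hK₃⟩ := (smooth_thinO_zero h.B_cont ((contDiff_frame h.smooth 0).inner ℝ
    (contDiff_dirD (contDiff_frame h.smooth 0) es))).exists_nonneg
  have hκc : ContDiff ℝ ∞ fun t : ℝ × ℝ × ℝ => dirD ex (fun t => S.g (t.1, t.2.1) 0 0) t :=
    contDiff_dirD (contDiff_chart (S.g_smooth 0 0)) ex
  obtain ⟨K₄, hK₄0, hK₄⟩ := (smooth_thinO_zero h.B_cont hκc).exists_nonneg
  -- `T β²` serves as the small quantity `e` of `abs_curvature_sub_le`; the weight of `K₂` matches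
  -- the term `2 ∂ₛE₀₁`.
  set T : ℝ := (∑ i, ∑ j, K i j) + K₁ + 2 * K₂ with hT
  have hKle : ∀ i j, K i j ≤ ∑ i, ∑ j, K i j := fun i j =>
    (Finset.single_le_sum (f := fun j => K i j) (fun j _ => hK0 i j) (Finset.mem_univ j)).trans
      (Finset.single_le_sum (f := fun i => ∑ j, K i j)
        (fun i _ => Finset.sum_nonneg fun j _ => hK0 i j) (Finset.mem_univ i))
  have hsum0 : 0 ≤ ∑ i, ∑ j, K i j := (hK0 0 0).trans (hKle 0 0)
  have hKT : ∀ i j, K i j ≤ T := fun i j => by have := hKle i j; linarith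
  have hT0 : 0 ≤ T := (hK0 0 0).trans (hKT 0 0)
  -- One bound for both the reference curvature and the tangential acceleration `⟨A, A'⟩`.
  set K₀ : ℝ := K₃ + K₄ with hK₀
  refine ⟨(40 * K₀ + 4) * T, ?_⟩
  have hsmall : ∀ᶠ β in 𝓝[>] (0 : ℝ), T * β ^ 2 ≤ 1 / 8 := by
    have ht : Tendsto (fun β : ℝ => T * β ^ 2) (𝓝[>] 0) (𝓝 0) := by
      have : Continuous fun β : ℝ => T * β ^ 2 := by fun_prop
      have := (this.tendsto 0).mono_left (nhdsWithin_le_nhds (s := Ioi 0))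
      simpa using this
    exact ht.eventually_le_const (by norm_num)
  filter_upwards [Ioc_mem_nhdsGT one_pos, hsmall] with β hβ hβT s hs
  have hβ2 : 0 ≤ β ^ 2 := sq_nonneg β
  have hmem : (s, (0 : ℝ)) ∈ stripDomain c d S.B β := center_mem_stripDomain h.B_pos hβ.1.le hs
  have hEbound : ∀ i j, |familyStrain S Q (s, 0, β) i j| ≤ T * β ^ 2 := fun i j =>
    (hK i j β hβ s hs).trans (mul_le_mul_of_nonneg_right (hKT i j) hβ2)
  have hTβ : 0 ≤ T * β ^ 2 := mul_nonneg hT0 hβ2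
  have hK₀0 : 0 ≤ K₀ := add_nonneg hK₃0 hK₄0
  constructor
  · intro i j
    have e : inducedMetric (p β) (s, 0) i j - S.g (s, 0) i j =
        2 * familyStrain S Q (s, 0, β) i j := by
      have := congrArg (fun M : Matrix (Fin 2) (Fin 2) ℝ => M i j) (h.strain_eq hβ hmem)
      simp only [strain, Matrix.smul_apply, Matrix.sub_apply, smul_eq_mul] at this
      linarith
    rw [e, abs_mul, abs_two]
    nlinarith [hEbound i j, mul_nonneg hK₀0 hTβ]
  · rw [h.planarCurvature_eq hβ hs, mul_assoc]
    have hdet : 0 < det2 (frame Q 0 (s, 0, β)) (frame Q 1 (s, 0, β)) := by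
      have := (h.minimizer β hβ).embedding.orientation _ (stripDomain_subset_D h.subset hmem)
      rwa [h.pd_eq hβ _ hmem, h.pd_eq hβ _ hmem] at this
    have hρ : |2 * dirD es (fun t => familyStrain S Q t 0 1) (s, 0, β) -
        dirD ex (fun t => familyStrain S Q t 0 0) (s, 0, β)| ≤ T * β ^ 2 := by
      have a1 := abs_le.1 (hK₁ β hβ s hs)
      have a2 := abs_le.1 (hK₂ β hβ s hs)
      have a3 : 0 ≤ (∑ i, ∑ j, K i j) * β ^ 2 := mul_nonneg hsum0 hβ2
      have a4 : T * β ^ 2 = (∑ i, ∑ j, K i j) * β ^ 2 + K₁ * β ^ 2 + 2 * (K₂ * β ^ 2) := by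
        rw [hT]; ring
      rw [abs_le, a4]
      constructor <;> linarith
    have hκ : |S.centerCurvature s| ≤ K₀ := by
      have b := hK₄ (s, 0, β) ⟨hβ, hmem⟩
      simp only [pow_zero, mul_one] at b
      have e := pd_chart (S.g_smooth 0 0) 1 (s, 0, β)
      rw [S.centerCurvature_eq h.lt h.subset hs, ← e]
      change |-(1 / 2) * dirD ex (fun t : ℝ × ℝ × ℝ => S.g (t.1, t.2.1) 0 0) (s, 0, β)| ≤ K₀
      rw [abs_mul, abs_neg, abs_of_pos (by norm_num : (0 : ℝ) < 1 / 2)]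
      have := abs_nonneg (dirD ex (fun t : ℝ × ℝ × ℝ => S.g (t.1, t.2.1) 0 0) (s, 0, β))
      linarith
    have hq := hK₃ (s, 0, β) ⟨hβ, hmem⟩
    simp only [pow_zero, mul_one] at hq
    have hAA := h.inner_frame (β := β) hs 0 0
    have hAD := h.inner_frame (β := β) hs 0 1
    have hDD := h.inner_frame (β := β) hs 1 1
    simp only [Matrix.one_apply_eq, ne_eq, zero_ne_one, not_false_eq_true, Matrix.one_apply_ne,
      zero_add] at hAA hAD hDD
    exact abs_curvature_sub_le hβT hdet hAA hAD hDD (h.inner_acceleration hs) rfl (hEbound 0 0)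
      (hEbound 0 1) (hEbound 1 1) hρ hκ (by linarith)

end IsMinimizingFamily

end Curvature

end ElasticStrip

theorem mainTheorem2
    (S : ElasticStrip.CenteredStrip)
    (C : ElasticStrip.StiffnessField) (lam mu : ℝ)
    (hC : C.IsIsotropic S lam mu) (hCpos : C.IsPositive S)
    (k : ℕ∞) (hk : 1 ≤ k)
    (p : ℝ → ℝ × ℝ → ElasticStrip.Plane)
    (hp : ∀ β ∈ Set.Ioc (0 : ℝ) 1, ElasticStrip.IsEnergyMinimizer S C k β (p β))
    (c d : ℝ) (hcd : c < d) (hJ : Set.Icc c d ⊆ Set.Icc S.a S.b)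
    (hsmooth : ElasticStrip.IsSmoothFamilyOver S (Set.Icc c d) p) :
    ∃ M : ℝ, ∀ᶠ β in nhdsWithin (0 : ℝ) (Set.Ioi 0), ∀ s ∈ Set.Icc c d,
      (∀ i j : Fin 2,
        |ElasticStrip.inducedMetric (p β) (s, 0) i j - S.g (s, 0) i j| ≤ M * β ^ 2) ∧
      |ElasticStrip.planarCurvature (Set.Icc c d) (fun x => p β (x, 0)) s
        - S.centerCurvature s| ≤ M * β ^ 2 := by
  obtain ⟨Q, hQ, hpQ⟩ := hsmooth
  exact ElasticStrip.IsMinimizingFamily.second_order ⟨hcd, hJ, hk, hQ, hp, hpQ⟩ hC hCpos
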